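/- Write $|\cdot|$ for the Euclidean norm on $\mathbb R^N$, $B_j$ for the closed ball of radius $j$ centred at $0$, and $f_\tau(t,x)=f(t+\tau,x)$. All functions $f\colon\mathbb R\times\mathbb R^N\to\mathbb R^M$ below are Borel and have, for each compact $K\subset\mathbb R^N$, an $m$-bound on $K$, that is, a function $m^K\in L^1_{loc}$ with $|f(t,x)|\le m^K(t)$ for a.e. $t$ and all $x\in K$. Such an $f$ is in $\mathfrak{LC}$ if for each compact $K$ there is $l^K\in L^1_{loc}$ with $|f(t,x)-f(t,y)|\le l^K(t)|x-y|$ for a.e. $t$ and all $x,y\in K$; it is in $\mathfrak{SC}$ if $f(t,\cdot)$ is continuous for a.e. $t$. It has $L^1_{loc}$-equicontinuous $m$-bounds if for each $j\in\mathbb N$ there is a set $S$ of nonnegative functions in $L^1_{loc}$ that contains an $m$-bound on $B_j$ of every translate $f_\tau$, $\tau\in\mathbb R$, and is such that for all $r,\varepsilon>0$ there is $\delta>0$ with $\int_s^t m<\varepsilon$ for all $m\in S$ and all $-r\le s\le t\le r$ with $t-s<\delta$. Let $f\colon\mathbb R\times\mathbb R^N\to\mathbb R^N$ be in $\mathfrak{LC}$,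 continuously differentiable in $x$ for a.e. $t$, with $L^1_{loc}$-equicontinuous $m$-bounds and with Jacobian $J_xf\in\mathfrak{SC}(\mathbb R^{N\times N})$. Put $\theta_j(s)=\sup_{t\in\mathbb R}\int_t^{t+s}\sup_{x\in B_j}|f(u,x)|\,du$ and $\Theta=(\theta_j)_{j}$. For $I=[q_1,q_2]$ with rational endpoints let $\mathcal K_j^I$ be the set of continuous $x\colon I\to B_j$ with $|x(t)-x(s)|\le\theta_j(|t-s|)$ for $s,t\in I$. Say that $F\in\Theta\mathfrak C$ (resp. $F\in\mathfrak W\Theta\mathfrak C$) if, whenever $x_n\to x$ uniformly on $I$ with $x_n,x\in\mathcal K_j^I$, one has $\int_I|F(t,x_n(t))-F(t,x(t))|\,dt\to0$ (resp. $\int_IF(t,x_n(t))\,dt\to\int_IF(t,x(t))\,dt$). Functions lying in the same one of these spaces and equal a.e. are identified. Let $\mathcal T_\Theta$ be the topology generated by the seminorms $\sup_{x\in\mathcal K_j^I}\int_I|F(t,x(t))|\,dt$, and $\sigma_\Theta$ the one generated by the seminorms $\sup_{x\in\mathcal K_j^I}\bigl|\int_IF(t,x(t))\,dt\bigr|$.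 Consider either of two settings. Strong setting: $\mathbb H$ is the closure of $\{(f_\tau,(J_xf)_\tau):\tau\in\mathbb R\}$ in $(\mathfrak{LC}\times\Theta\mathfrak C,\mathcal T_\Theta\times\mathcal T_\Theta)$. Weak setting: $J_xf$ also has $L^1_{loc}$-equicontinuous $m$-bounds and $\mathbb H$ is the closure of the same set in $(\mathfrak{LC}\times\mathfrak W\Theta\mathfrak C,\sigma_\Theta\times\sigma_\Theta)$. Assume that for all $(g,G)\in\mathbb H$ and $x_0\in\mathbb R^N$ the Carathéodory solution $x(t,g,x_0)$ of $\dot x=g(t,x)$, $x(0)=x_0$, is defined for all $t\in\mathbb R$. Let $\Omega=\mathbb H\times\mathbb R^N$ with the product topology, and for $\omega=(g,G,x_0)\in\Omega$ put $\omega_t=(g_t,G_t,x(t,g,x_0))$ and $A(\omega)=\lim_{h\to0}\frac1h\int_0^hG(s,x(s,g,x_0))\,ds$ if the limit exists, $A(\omega)=0$ otherwise. (For a.e. $t$, $A(\omega_t)=G(t,x(t,g,x_0))$.) Let $\Phi(t,\omega)$ be the fundamental matrix solution of $\dot y=A(\omega_t)y$ with $\Phi(0,\omega)=\mathrm I_N$;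 the linearized skew-product flow is $(t,\omega,y_0)\mapsto(\omega_t,\Phi(t,\omega)y_0)$. For $J\in\{(-\infty,0],[0,\infty),\mathbb R\}$ and $\Delta\subset\Omega$, the flow has exponential dichotomy on $J$ over $\Delta$ if there are a continuous map $P\colon\Delta\to\mathcal L(\mathbb R^N,\mathbb R^N)$ whose values are projections and constants $K\ge1$, $\alpha>0$ such that for all $\omega\in\Delta$ and $s,t\in J$ $$\|\Phi(t,\omega)P(\omega)\Phi^{-1}(s,\omega)\|\le Ke^{-\alpha(t-s)}\ \text{ if } t\ge s,\qquad \|\Phi(t,\omega)(\mathrm I_N-P(\omega))\Phi^{-1}(s,\omega)\|\le Ke^{\alpha(t-s)}\ \text{ if } t\le s.$$ The single system $\dot y=A(\omega_t)y$ has exponential dichotomy on $J$ if this holds with $\Delta=\{\omega\}$. Let $\mathbb A(\omega)$ (resp. $\mathbb O(\omega)$) be the set of limits in $\Omega$ of sequences $\omega_{t_n}$ with $t_n\to-\infty$ (resp. $t_n\to+\infty$), and $\mathbb H(\omega)$ the closure in $\Omega$ of $\{\omega_t:t\in\mathbb R\}$. Then, in either setting, for every $\omega\in\Omega$: (i) if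 $\dot y=A(\omega_t)y$ has exponential dichotomy on $(-\infty,0]$, then the flow has exponential dichotomy on $\mathbb R$ over $\mathbb A(\omega)$; (ii) if $\dot y=A(\omega_t)y$ has exponential dichotomy on $[0,\infty)$, then the flow has exponential dichotomy on $\mathbb R$ over $\mathbb O(\omega)$; (iii) if $\dot y=A(\omega_t)y$ has exponential dichotomy on $\mathbb R$, then the flow has exponential dichotomy on $\mathbb R$ over $\mathbb H(\omega)$. -/

import Mathlib

open MeasureTheory Set Filter Topology

namespace CarathODE

/-- Euclidean space `ℝ^N`. -/
abbrev Euc (N : ℕ) : Type := EuclideanSpace ℝ (Fin N)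

/-- `N × N` real matrices, viewed as linear maps of `ℝ^N` (with the operator norm). -/
abbrev Mat (N : ℕ) : Type := Euc N →L[ℝ] Euc N

section Spaces

variable {N : ℕ} {V : Type*} [NormedAddCommGroup V] [NormedSpace ℝ V]

/-- `m` is an `m`-bound of `f` on `K`: a locally integrable function such that, for almost every
`t`, one has `‖f (t, x)‖ ≤ m t` for all `x ∈ K`. -/
def IsMBound (f : ℝ × Euc N → V) (K : Set (Euc N)) (m : ℝ → ℝ) : Prop :=
  LocallyIntegrable m ∧ ∀ᵐ t : ℝ, ∀ x ∈ K, ‖f (t, x)‖ ≤ m t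

lemma IsMBound.add {f g : ℝ × Euc N → V} {K : Set (Euc N)} {m n : ℝ → ℝ}
    (hf : IsMBound f K m) (hg : IsMBound g K n) : IsMBound (f + g) K (m + n) := by
  refine ⟨hf.1.add hg.1, ?_⟩
  filter_upwards [hf.2, hg.2] with t h1 h2 x hx
  exact (norm_add_le _ _).trans (add_le_add (h1 x hx) (h2 x hx))

lemma IsMBound.smul {f : ℝ × Euc N → V} {K : Set (Euc N)} {m : ℝ → ℝ}
    (c : ℝ) (hf : IsMBound f K m) : IsMBound (c • f) K (fun t => ‖c‖ * m t) := by
  refine ⟨hf.1.smul ‖c‖, ?_⟩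
  filter_upwards [hf.2] with t h1 x hx
  rw [Pi.smul_apply, norm_smul]
  exact mul_le_mul_of_nonneg_left (h1 x hx) (norm_nonneg c)

lemma IsMBound.shift {f : ℝ × Euc N → V} {K : Set (Euc N)} {m : ℝ → ℝ}
    (τ : ℝ) (hf : IsMBound f K m) :
    IsMBound (fun p => f (p.1 + τ, p.2)) K (fun t => m (t + τ)) := by
  have mp := measurePreserving_add_right (volume : Measure ℝ) τ
  refine ⟨?_, mp.quasiMeasurePreserving.ae hf.2⟩
  rw [locallyIntegrable_iff]
  intro k hk
  have hk' : IsCompact ((fun t : ℝ => t + τ) '' k) := hk.image (by fun_prop)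
  have h := hf.1.integrableOn_isCompact hk'
  have h2 := (mp.integrableOn_comp_preimage
    (Homeomorph.addRight τ).measurableEmbedding (f := m)).2 h
  exact h2.mono_set (subset_preimage_image _ _)

variable [MeasurableSpace V] [BorelSpace V] [SecondCountableTopology V]

variable (N V) in
/-- The vector space of Borel functions `f : ℝ × ℝ^N → V` having a locally integrable `m`-bound on
every compact set. -/
def carSubmodule : Submodule ℝ (ℝ × Euc N → V) where
  carrier := {f | Measurable f ∧ ∀ K : Set (Euc N), IsCompact K → ∃ m, IsMBound f K m}
  add_mem' := by
    rintro f g ⟨hf, hf'⟩ ⟨hg, hg'⟩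
    refine ⟨hf.add hg, fun K hK => ?_⟩
    obtain ⟨m, hm⟩ := hf' K hK
    obtain ⟨n, hn⟩ := hg' K hK
    exact ⟨_, hm.add hn⟩
  zero_mem' := ⟨measurable_const, fun K _ => ⟨0, locallyIntegrable_zero,
    by filter_upwards with t x _; simp⟩⟩
  smul_mem' := by
    rintro c f ⟨hf, hf'⟩
    refine ⟨hf.const_smul c, fun K hK => ?_⟩
    obtain ⟨m, hm⟩ := hf' K hK
    exact ⟨_, hm.smul c⟩

variable (N V) in
/-- The space `𝔠` of functions `ℝ × ℝ^N → V` satisfying (C1) Borel measurability and (C2) existence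
of locally integrable `m`-bounds on compact sets. It carries no canonical topology; the topologies
in use are introduced explicitly below. Elements are genuine functions; two of them lying in one of
the subspaces below and agreeing almost everywhere are topologically indistinguishable there. -/
def Car : Type _ := carSubmodule N V

noncomputable instance : AddCommGroup (Car N V) := inferInstanceAs (AddCommGroup (carSubmodule N V))

noncomputable instance : Module ℝ (Car N V) := inferInstanceAs (Module ℝ (carSubmodule N V))

instance : CoeFun (Car N V) (fun _ => ℝ × Euc N → V) := ⟨fun f => f.1⟩

lemma Car.add_apply (f g : Car N V) (p : ℝ × Euc N) : (f + g) p = f p + g p := rfl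

lemma Car.smul_apply (c : ℝ) (f : Car N V) (p : ℝ × Euc N) : (c • f) p = c • f p := rfl

/-- The time translation `f_τ (t, x) = f (t + τ, x)`. -/
def Car.shift (τ : ℝ) (f : Car N V) : Car N V :=
  ⟨fun p => f (p.1 + τ, p.2), f.2.1.comp (by fun_prop), fun K hK =>
    let ⟨m, hm⟩ := f.2.2 K hK
    ⟨_, hm.shift τ⟩⟩

/-- Lipschitz Carathéodory functions: local Lipschitz constants in `x` are locally integrable. -/
def IsLC (f : Car N V) : Prop :=
  ∀ K : Set (Euc N), IsCompact K → ∃ l : ℝ → ℝ, LocallyIntegrable l ∧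
    ∀ᵐ t : ℝ, ∀ x ∈ K, ∀ y ∈ K, ‖f (t, x) - f (t, y)‖ ≤ l t * ‖x - y‖

/-- Strong Carathéodory functions. -/
def IsSC (f : Car N V) : Prop := ∀ᵐ t : ℝ, Continuous fun x => f (t, x)

/-- The set `𝒦_j^I`, `I = [q₁, q₂]`, of continuous functions `x : I → B_j` admitting `Θ j` as a
modulus of continuity (functions are regarded on all of `ℝ`, only their values on `I` matter). -/
def modSet (N : ℕ) (Θ : ℕ → ℝ → ℝ) (q : ℚ × ℚ) (j : ℕ) : Set (ℝ → Euc N) :=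
  {x | ContinuousOn x (Icc (q.1 : ℝ) q.2) ∧
    (∀ t ∈ Icc (q.1 : ℝ) q.2, x t ∈ Metric.closedBall (0 : Euc N) j) ∧
    ∀ s ∈ Icc (q.1 : ℝ) q.2, ∀ t ∈ Icc (q.1 : ℝ) q.2, ‖x t - x s‖ ≤ Θ j |t - s|}

/-- `Θ`-Carathéodory functions. -/
def IsTC (Θ : ℕ → ℝ → ℝ) (f : Car N V) : Prop :=
  ∀ (q : ℚ × ℚ) (j : ℕ) (x : ℕ → ℝ → Euc N) (y : ℝ → Euc N),
    (∀ n, x n ∈ modSet N Θ q j) → y ∈ modSet N Θ q j →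
    TendstoUniformlyOn x y atTop (Icc (q.1 : ℝ) q.2) →
    Tendsto (fun n => ∫ t in Icc (q.1 : ℝ) q.2, ‖f (t, x n t) - f (t, y t)‖) atTop (𝓝 0)

/-- Weak `Θ`-Carathéodory functions. -/
def IsWTC (Θ : ℕ → ℝ → ℝ) (f : Car N V) : Prop :=
  ∀ (q : ℚ × ℚ) (j : ℕ) (x : ℕ → ℝ → Euc N) (y : ℝ → Euc N),
    (∀ n, x n ∈ modSet N Θ q j) → y ∈ modSet N Θ q j →
    TendstoUniformlyOn x y atTop (Icc (q.1 : ℝ) q.2) →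
    Tendsto (fun n => ∫ t in Icc (q.1 : ℝ) q.2, f (t, x n t)) atTop
      (𝓝 (∫ t in Icc (q.1 : ℝ) q.2, f (t, y t)))

lemma Car.exists_bound (f : Car N V) (Θ : ℕ → ℝ → ℝ) (q : ℚ × ℚ) (j : ℕ) :
    ∃ C : ℝ, ∀ x ∈ modSet N Θ q j,
      IntegrableOn (fun t => f (t, x t)) (Icc (q.1 : ℝ) q.2) ∧
      ∫ t in Icc (q.1 : ℝ) q.2, ‖f (t, x t)‖ ≤ C := by
  obtain ⟨m, hm, hb⟩ := f.2.2 (Metric.closedBall (0 : Euc N) j) (isCompact_closedBall _ _)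
  have hmi : IntegrableOn m (Icc (q.1 : ℝ) q.2) := hm.integrableOn_isCompact isCompact_Icc
  refine ⟨∫ t in Icc (q.1 : ℝ) q.2, m t, fun x hx => ?_⟩
  have hb' : ∀ᵐ t ∂(volume.restrict (Icc (q.1 : ℝ) q.2)), ‖f (t, x t)‖ ≤ m t := by
    filter_upwards [ae_restrict_of_ae hb, ae_restrict_mem measurableSet_Icc] with t h1 h2
    exact h1 _ (hx.2.1 t h2)
  have hxm : AEMeasurable x (volume.restrict (Icc (q.1 : ℝ) q.2)) :=
    hx.1.aemeasurable measurableSet_Icc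
  have hi : IntegrableOn (fun t => f (t, x t)) (Icc (q.1 : ℝ) q.2) :=
    Integrable.mono' hmi
      ((f.2.1.comp_aemeasurable (aemeasurable_id.prodMk hxm)).aestronglyMeasurable) hb'
  exact ⟨hi, integral_mono_ae hi.norm hmi hb'⟩

/-- The seminorm `f ↦ sup_{x ∈ 𝒦_j^I} |∫_I f(t, x(t)) dt|`. -/
noncomputable def weakSeminorm (N : ℕ) (V : Type*) [NormedAddCommGroup V] [NormedSpace ℝ V]
    [MeasurableSpace V] [BorelSpace V] [SecondCountableTopology V]
    (Θ : ℕ → ℝ → ℝ) (i : (ℚ × ℚ) × ℕ) : Seminorm ℝ (Car N V) :=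
  Seminorm.of
    (fun f => ⨆ x : modSet N Θ i.1 i.2,
      ‖∫ t in Icc (i.1.1 : ℝ) i.1.2, f (t, (x : ℝ → Euc N) t)‖)
    (by
      intro f g
      have key : ∀ h : Car N V, BddAbove (range fun x : modSet N Θ i.1 i.2 =>
          ‖∫ t in Icc (i.1.1 : ℝ) i.1.2, h (t, (x : ℝ → Euc N) t)‖) := by
        intro h
        obtain ⟨C, hC⟩ := h.exists_bound Θ i.1 i.2
        refine ⟨C, ?_⟩
        rintro _ ⟨x, rfl⟩
        exact (norm_integral_le_integral_norm _).trans (hC x x.2).2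
      refine Real.iSup_le (fun x => ?_) (add_nonneg (Real.iSup_nonneg fun _ => norm_nonneg _)
        (Real.iSup_nonneg fun _ => norm_nonneg _))
      obtain ⟨_, hf⟩ := f.exists_bound Θ i.1 i.2
      obtain ⟨_, hg⟩ := g.exists_bound Θ i.1 i.2
      simp only [Car.add_apply]
      rw [integral_add (hf x x.2).1 (hg x x.2).1]
      exact (norm_add_le _ _).trans (add_le_add (le_ciSup (key f) x) (le_ciSup (key g) x)))
    (by
      intro c f
      simp only [Car.smul_apply, integral_smul, norm_smul]
      rw [Real.mul_iSup_of_nonneg (norm_nonneg c)])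

/-- The seminorm `f ↦ sup_{x ∈ 𝒦_j^I} ∫_I |f(t, x(t))| dt`. -/
noncomputable def strongSeminorm (N : ℕ) (V : Type*) [NormedAddCommGroup V] [NormedSpace ℝ V]
    [MeasurableSpace V] [BorelSpace V] [SecondCountableTopology V]
    (Θ : ℕ → ℝ → ℝ) (i : (ℚ × ℚ) × ℕ) : Seminorm ℝ (Car N V) :=
  Seminorm.of
    (fun f => ⨆ x : modSet N Θ i.1 i.2,
      ∫ t in Icc (i.1.1 : ℝ) i.1.2, ‖f (t, (x : ℝ → Euc N) t)‖)
    (by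
      intro f g
      have key : ∀ h : Car N V, BddAbove (range fun x : modSet N Θ i.1 i.2 =>
          ∫ t in Icc (i.1.1 : ℝ) i.1.2, ‖h (t, (x : ℝ → Euc N) t)‖) := by
        intro h
        obtain ⟨C, hC⟩ := h.exists_bound Θ i.1 i.2
        refine ⟨C, ?_⟩
        rintro _ ⟨x, rfl⟩
        exact (hC x x.2).2
      have nn : ∀ (h : Car N V) (x : modSet N Θ i.1 i.2),
          0 ≤ ∫ t in Icc (i.1.1 : ℝ) i.1.2, ‖h (t, (x : ℝ → Euc N) t)‖ :=
        fun h x => integral_nonneg fun _ => norm_nonneg _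
      refine Real.iSup_le (fun x => ?_) (add_nonneg (Real.iSup_nonneg (nn f))
        (Real.iSup_nonneg (nn g)))
      obtain ⟨_, hf⟩ := f.exists_bound Θ i.1 i.2
      obtain ⟨_, hg⟩ := g.exists_bound Θ i.1 i.2
      refine le_trans ?_ (add_le_add (le_ciSup (key f) x) (le_ciSup (key g) x))
      rw [← integral_add (hf x x.2).1.norm (hg x x.2).1.norm]
      refine integral_mono ((hf x x.2).1.add (hg x x.2).1).norm
        ((hf x x.2).1.norm.add (hg x x.2).1.norm) (fun t => ?_)
      exact norm_add_le _ _)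
    (by
      intro c f
      simp only [Car.smul_apply, norm_smul, integral_const_mul]
      rw [Real.mul_iSup_of_nonneg (norm_nonneg c)])

/-- The two settings: the strong topology `𝒯_Θ` (with the space `ΘC`) or the weak topology `σ_Θ`
(with the space `WΘC`). -/
inductive Mode
  | strong
  | weak

/-- The family of seminorms generating the topology of the given setting. -/
noncomputable def seminorms (mode : Mode) (N : ℕ) (V : Type*) [NormedAddCommGroup V]
    [NormedSpace ℝ V] [MeasurableSpace V] [BorelSpace V] [SecondCountableTopology V]
    (Θ : ℕ → ℝ → ℝ) : SeminormFamily ℝ (Car N V) ((ℚ × ℚ) × ℕ) :=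
  match mode with
  | .strong => strongSeminorm N V Θ
  | .weak => weakSeminorm N V Θ

/-- The topology `𝒯_Θ` (strong) or `σ_Θ` (weak) on `Car N V`. -/
@[reducible] noncomputable def carTopology (mode : Mode) (Θ : ℕ → ℝ → ℝ) (N : ℕ) (V : Type*)
    [NormedAddCommGroup V] [NormedSpace ℝ V] [MeasurableSpace V] [BorelSpace V]
    [SecondCountableTopology V] : TopologicalSpace (Car N V) :=
  (seminorms mode N V Θ).moduleFilterBasis.topology

/-- Membership in `ΘC` (strong setting) or `WΘC` (weak setting). -/
def IsThetaC (mode : Mode) (Θ : ℕ → ℝ → ℝ) (f : Car N V) : Prop :=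
  match mode with
  | .strong => IsTC Θ f
  | .weak => IsWTC Θ f

/-- `L¹_loc`-equicontinuity of a set of locally integrable functions. -/
def L1locEquicontinuous (S : Set (ℝ → ℝ)) : Prop :=
  ∀ r > (0 : ℝ), ∀ ε > (0 : ℝ), ∃ δ > (0 : ℝ), ∀ s t : ℝ, -r ≤ s → s ≤ t → t ≤ r → t - s < δ →
    ∀ m ∈ S, ∫ u in s..t, m u < ε

/-- `f` has `L¹_loc`-equicontinuous `m`-bounds: for each `j` the translates of `f` admit `m`-bounds
on `B_j` forming an `L¹_loc`-equicontinuous set of nonnegative functions. -/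
def HasEquicontinuousMBounds (f : Car N V) : Prop :=
  ∀ j : ℕ, ∃ S : Set (ℝ → ℝ),
    (∀ m ∈ S, LocallyIntegrable m ∧ ∀ᵐ t : ℝ, 0 ≤ m t) ∧
    (∀ τ : ℝ, ∃ m ∈ S, IsMBound (f.shift τ) (Metric.closedBall (0 : Euc N) j) m) ∧
    L1locEquicontinuous S

/-- The optimal `m`-bound of `f` on the ball `B_j`. -/
noncomputable def optMBound (f : Car N V) (j : ℕ) (t : ℝ) : ℝ :=
  ⨆ x : Metric.closedBall (0 : Euc N) j, ‖f (t, (x : Euc N))‖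

/-- The moduli of continuity `θ_j(s) = sup_t ∫_t^{t+s} m^j(u) du` determined by the optimal
`m`-bounds of `f`. -/
noncomputable def theta (f : Car N V) (j : ℕ) (s : ℝ) : ℝ :=
  ⨆ t : ℝ, ∫ u in t..(t + s), optMBound f j u

end Spaces

section Flow

variable {N : ℕ}

/-- `f` is continuously differentiable in `x` for a.e. `t`, and `F` is its Jacobian in `x`. -/
def IsJacobian (f : Car N (Euc N)) (F : Car N (Mat N)) : Prop :=
  ∀ᵐ t : ℝ, ContDiff ℝ 1 (fun x => f (t, x)) ∧ ∀ x, F (t, x) = fderiv ℝ (fun x => f (t, x)) x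

/-- Global Carathéodory solutions of `ẋ = g(t, x)`, `x(0) = x₀`. -/
def IsSolution (g : Car N (Euc N)) (x₀ : Euc N) (x : ℝ → Euc N) : Prop :=
  Continuous x ∧ ∀ t, x t = x₀ + ∫ s in (0 : ℝ)..t, g (s, x s)

open Classical in
/-- The solution `x(·, g, x₀)`, if it is globally defined. -/
noncomputable def sol (g : Car N (Euc N)) (x₀ : Euc N) : ℝ → Euc N :=
  if h : ∃ x, IsSolution g x₀ x then h.choose else 0

variable (N) in
/-- Triples `(g, G, x₀)`. -/
abbrev Triple : Type := Car N (Euc N) × Car N (Mat N) × Euc N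

/-- The product topology on pairs `(g, G)` in the given setting. -/
@[reducible] noncomputable def pairTopology (mode : Mode) (Θ : ℕ → ℝ → ℝ) (N : ℕ) :
    TopologicalSpace (Car N (Euc N) × Car N (Mat N)) :=
  @instTopologicalSpaceProd _ _ (carTopology mode Θ N (Euc N)) (carTopology mode Θ N (Mat N))

/-- The product topology on triples `(g, G, x₀)` in the given setting. -/
@[reducible] noncomputable def tripleTopology (mode : Mode) (Θ : ℕ → ℝ → ℝ) (N : ℕ) :
    TopologicalSpace (Triple N) :=
  @instTopologicalSpaceProd _ _ (carTopology mode Θ N (Euc N))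
    (@instTopologicalSpaceProd _ _ (carTopology mode Θ N (Mat N)) inferInstance)

/-- The hull of `(f, F)`: the closure in `LC × ΘC` (strong) or `LC × WΘC` (weak) of the set of
translates `(f_τ, F_τ)`, where `Θ` is given by the optimal `m`-bounds of `f`. -/
def hull (mode : Mode) (f : Car N (Euc N)) (F : Car N (Mat N)) :
    Set (Car N (Euc N) × Car N (Mat N)) :=
  {p | IsLC p.1 ∧ IsThetaC mode (theta f) p.2 ∧
    p ∈ @closure _ (pairTopology mode (theta f) N) (range fun τ : ℝ => (f.shift τ, F.shift τ))}

/-- The base space `Ω = hull × ℝ^N` of the linearized skew-product flow. -/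
def Omega (mode : Mode) (f : Car N (Euc N)) (F : Car N (Mat N)) : Set (Triple N) :=
  {ω | (ω.1, ω.2.1) ∈ hull mode f F}

/-- The base flow `ω_t = (g_t, G_t, x(t, g, x₀))`. -/
noncomputable def baseFlow (t : ℝ) (ω : Triple N) : Triple N :=
  (ω.1.shift t, ω.2.1.shift t, sol ω.1 ω.2.2 t)

open Classical in
/-- `A(ω) = lim_{h → 0} h⁻¹ ∫_0^h G(s, x(s, g, x₀)) ds` if the limit exists, and `0` otherwise. -/
noncomputable def coeffA (ω : Triple N) : Mat N :=
  if h : ∃ L : Mat N, Tendsto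
      (fun h : ℝ => h⁻¹ • ∫ s in (0 : ℝ)..h, ω.2.1 (s, sol ω.1 ω.2.2 s)) (𝓝[≠] 0) (𝓝 L)
  then h.choose else 0

/-- `Φ` is a (Carathéodory) fundamental matrix solution of `ẏ = A(ω_t) y` with `Φ(0) = I`. -/
def IsFundamental (ω : Triple N) (Φ : ℝ → Mat N) : Prop :=
  Continuous Φ ∧ ∀ t, Φ t = 1 + ∫ s in (0 : ℝ)..t, coeffA (baseFlow s ω) * Φ s

open Classical in
/-- The fundamental matrix solution `Φ(t, ω)` of `ẏ = A(ω_t) y` with `Φ(0, ω) = I`. -/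
noncomputable def fundMat (t : ℝ) (ω : Triple N) : Mat N :=
  if h : ∃ Φ, IsFundamental ω Φ then h.choose t else 1

/-- The family `ẏ = A(ω_t) y`, equivalently the linear skew-product flow, has exponential dichotomy
on `I` over `Δ`, with projections depending continuously on `ω ∈ Δ`. -/
def HasExpDichotomy (mode : Mode) (Θ : ℕ → ℝ → ℝ) (I : Set ℝ) (Δ : Set (Triple N)) : Prop :=
  ∃ P : Triple N → Mat N,
    @ContinuousOn _ _ (tripleTopology mode Θ N) inferInstance P Δ ∧
    (∀ ω ∈ Δ, IsIdempotentElem (P ω)) ∧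
    ∃ K : ℝ, 1 ≤ K ∧ ∃ α : ℝ, 0 < α ∧ ∀ s ∈ I, ∀ t ∈ I, ∀ ω ∈ Δ,
      (s ≤ t → ‖fundMat t ω * P ω * Ring.inverse (fundMat s ω)‖ ≤ K * Real.exp (-α * (t - s))) ∧
      (t ≤ s → ‖fundMat t ω * (1 - P ω) * Ring.inverse (fundMat s ω)‖
        ≤ K * Real.exp (α * (t - s)))

/-- The alpha limit set of `ω` in `Ω`. -/
def alphaLimit (mode : Mode) (f : Car N (Euc N)) (F : Car N (Mat N)) (ω : Triple N) :
    Set (Triple N) :=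
  {ω' | ω' ∈ Omega mode f F ∧ ∃ t : ℕ → ℝ, Tendsto t atTop atBot ∧
    Tendsto (fun n => baseFlow (t n) ω) atTop (@nhds _ (tripleTopology mode (theta f) N) ω')}

/-- The omega limit set of `ω` in `Ω`. -/
def omegaLimit (mode : Mode) (f : Car N (Euc N)) (F : Car N (Mat N)) (ω : Triple N) :
    Set (Triple N) :=
  {ω' | ω' ∈ Omega mode f F ∧ ∃ t : ℕ → ℝ, Tendsto t atTop atTop ∧
    Tendsto (fun n => baseFlow (t n) ω) atTop (@nhds _ (tripleTopology mode (theta f) N) ω')}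

/-- The hull of `ω`: the closure in `Ω` of its orbit. -/
def orbitHull (mode : Mode) (f : Car N (Euc N)) (F : Car N (Mat N)) (ω : Triple N) :
    Set (Triple N) :=
  {ω' | ω' ∈ Omega mode f F ∧
    ω' ∈ @closure _ (tripleTopology mode (theta f) N) (range fun t : ℝ => baseFlow t ω)}

end Flow

end CarathODE

/-! Conjugating a dichotomy projection of ω by Φ(τ, ω) gives a projection for ω_τ that satisfies the
same estimates, with the same K and α, at all times t with t + τ ∈ J. When τ tends to the infinite
end of J, these times exhaust ℝ. The transported projections have norm at most K, so in finite
dimension they converge along an ultrafilter. The dichotomy estimates are closed conditions on Φ and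
P, so the limit is a dichotomy projection on all of ℝ at the limit point ω'
(`exists_dichotomyBound_of_tendsto`). On the whole line the projection is unique
(`DichotomyBound.unique`), and the same compactness argument then makes it continuous in the base
point (`hasExpDichotomy_univ_of_forall`).

Everything rests on the continuity of ω ↦ Φ(t, ω) in both settings (`ConvergesTo.tendsto_fundMat`).
The seminorms only see curves with modulus θ_j, so solutions of every g in the hull must be shown to
have it: the bound by θ_j passes from the translates of f to their limits
(`norm_integral_le_theta_of_tendsto`). Solutions then depend continuously on (g, x₀)
(`eventually_norm_traj_sub_le`), and the coefficients G(s, x(s)), which equal A(ω_s) for a.e. s,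
converge in the sense of integrals over rational intervals. Together with equi-integrability, this
weak convergence suffices for the linear systems (`tendsto_isPrincipal`). Equi-integrability comes
from L¹ convergence in the strong setting. In the weak one it comes from the bounds on ∫ ‖G(u,
x(u))‖ du by `theta F`, which limits inherit (`integral_norm_le_theta_of_tendsto`). -/

namespace CarathODE

/-! ### Grönwall's inequality with a locally integrable kernel -/

section Gronwall

lemma _root_.MeasureTheory.LocallyIntegrable.toIntervalIntegrable {E : Type*}
    [NormedAddCommGroup E] {l : ℝ → E} (hl : LocallyIntegrable l) {a b : ℝ} :
    IntervalIntegrable l volume a b :=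
  (hl.integrableOn_isCompact isCompact_uIcc).intervalIntegrable

lemma _root_.MeasureTheory.LocallyIntegrable.toNorm {E : Type*}
    [NormedAddCommGroup E] {l : ℝ → E} (hl : LocallyIntegrable l) :
    LocallyIntegrable fun t => ‖l t‖ :=
  fun t => (hl t).norm

/-- The integral inequality behind the weighted-norm (Bielecki) argument. -/
lemma abs_integral_mul_exp_le {l : ℝ → ℝ} (hl : LocallyIntegrable l) (h0 : ∀ t, 0 ≤ l t) (t : ℝ) :
    |∫ s in (0 : ℝ)..t, l s * Real.exp (2 * |∫ u in (0 : ℝ)..s, l u|)| ≤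
      Real.exp (2 * |∫ u in (0 : ℝ)..t, l u|) / 2 := by
  have hi : ∀ a b, IntervalIntegrable l volume a b := fun a b => hl.toIntervalIntegrable
  set a : ℝ → ℝ := fun s => ∫ u in (0 : ℝ)..s, l u with ha
  have hmono : Monotone a := by
    intro x y hxy
    have := intervalIntegral.integral_add_adjacent_intervals (hi 0 x) (hi x y)
    have h2 := intervalIntegral.integral_nonneg (μ := volume) hxy (fun u _ => h0 u)
    simp only [ha]; linarith
  have hder := _root_.LocallyIntegrable.ae_hasDerivAt_integral hl
  have ha0 : a 0 = 0 := by simp [ha]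
  rcases le_total 0 t with ht | ht
  · have hm : MonotoneOn (fun s => Real.exp (2 * a s) / 2) (uIcc 0 t) := by
      intro x _ y _ hxy
      have := hmono hxy
      simp only
      gcongr
    have key := hm.intervalIntegral_deriv_mem_uIcc
    have hat : 0 ≤ a t := ha0 ▸ hmono ht
    have heq : ∫ s in (0 : ℝ)..t, l s * Real.exp (2 * |a s|) =
        ∫ s in (0 : ℝ)..t, deriv (fun s => Real.exp (2 * a s) / 2) s := by
      apply intervalIntegral.integral_congr_ae
      filter_upwards [hder] with s hs hst
      rw [uIoc_of_le ht] at hst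
      have has : 0 ≤ a s := ha0 ▸ hmono hst.1.le
      have h1 : HasDerivAt a (l s) s := hs 0
      have h2 := ((h1.const_mul 2).exp.div_const 2).deriv
      rw [h2, abs_of_nonneg has]; ring
    rw [heq]
    have h3 : (0 : ℝ) ≤ Real.exp (2 * a t) / 2 - Real.exp (2 * a 0) / 2 := by
      rw [ha0]; have := Real.one_le_exp (show 0 ≤ 2 * a t by positivity); simp; linarith
    rw [uIcc_of_le h3] at key
    rw [abs_of_nonneg key.1, abs_of_nonneg hat]
    rw [ha0] at key
    have := key.2
    simp at this ⊢; linarith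
  -- For t ≤ 0 one has |a| = −a; the outer minus sign keeps the antiderivative increasing.
  · have hm : MonotoneOn (fun s => -(Real.exp (-(2 * a s)) / 2)) (uIcc 0 t) := by
      intro x _ y _ hxy
      have := hmono hxy
      simp only
      gcongr
    have key := hm.intervalIntegral_deriv_mem_uIcc
    have hat : a t ≤ 0 := ha0 ▸ hmono ht
    have heq : ∫ s in (0 : ℝ)..t, l s * Real.exp (2 * |a s|) =
        ∫ s in (0 : ℝ)..t, deriv (fun s => -(Real.exp (-(2 * a s)) / 2)) s := by
      apply intervalIntegral.integral_congr_ae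
      filter_upwards [hder] with s hs hst
      rw [uIoc_of_ge ht] at hst
      have has : a s ≤ 0 := ha0 ▸ hmono hst.2
      have h1 : HasDerivAt a (l s) s := hs 0
      have h2 := (((h1.const_mul 2).neg.exp.div_const 2).neg).deriv
      have h2' : deriv (fun s => -(Real.exp (-(2 * a s)) / 2)) s = _ := h2
      rw [h2', abs_of_nonpos has]
      simp
      ring
    rw [heq]
    have h3 : -(Real.exp (-(2 * a t)) / 2) - -(Real.exp (-(2 * a 0)) / 2) ≤ 0 := by
      rw [ha0]; have := Real.one_le_exp (show 0 ≤ -(2 * a t) by linarith); simp; linarith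
    rw [uIcc_of_ge h3] at key
    rw [abs_of_nonpos key.2, abs_of_nonpos hat]
    rw [ha0] at key
    have := key.1
    simp at this ⊢; linarith

lemma continuous_integral_of_locallyIntegrable {E : Type*} [NormedAddCommGroup E] [NormedSpace ℝ E]
    {l : ℝ → E} (hl : LocallyIntegrable l) :
    Continuous fun t => ∫ u in (0 : ℝ)..t, l u :=
  intervalIntegral.continuous_primitive (fun _ _ => hl.toIntervalIntegrable) 0

/-- A two-sided Grönwall inequality with a locally integrable kernel. -/
lemma gronwall_abs {l u : ℝ → ℝ} {ε T : ℝ} (hl : LocallyIntegrable l) (h0 : ∀ t, 0 ≤ l t)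
    (hu : Continuous u) (hu0 : ∀ t, 0 ≤ u t)
    (h : ∀ t, |t| ≤ T → u t ≤ ε + |∫ s in (0 : ℝ)..t, l s * u s|) {t : ℝ} (ht : |t| ≤ T) :
    u t ≤ 2 * ε * Real.exp (2 * |∫ s in (0 : ℝ)..t, l s|) := by
  set w : ℝ → ℝ := fun s => Real.exp (2 * |∫ u in (0 : ℝ)..s, l u|) with hw
  have hwc : Continuous w := by
    have := continuous_integral_of_locallyIntegrable hl
    fun_prop
  have hwpos : ∀ s, 0 < w s := fun s => Real.exp_pos _
  have hw1 : ∀ s, 1 ≤ w s := fun s => Real.one_le_exp (by positivity)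
  have hT : 0 ≤ T := (abs_nonneg t).trans ht
  -- With M the maximum of u / w, the factor 2 in the exponent of w turns the integral term into at
  -- most M w / 2, which can be absorbed.
  obtain ⟨s₀, hs₀, hmax⟩ := (isCompact_Icc (a := -T) (b := T)).exists_isMaxOn
    ⟨0, by constructor <;> linarith⟩
    ((hu.div hwc fun s => (hwpos s).ne').continuousOn)
  set M := u s₀ / w s₀ with hM
  have hM0 : 0 ≤ M := div_nonneg (hu0 _) (hwpos _).le
  have hle : ∀ s, |s| ≤ T → u s ≤ M * w s := by
    intro s hs
    have h1 := hmax (abs_le.1 hs)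
    simp only [mem_ofPred_eq, Pi.div_apply] at h1
    rwa [div_le_iff₀ (hwpos s)] at h1
  have hint : ∀ s, |s| ≤ T → |∫ r in (0 : ℝ)..s, l r * u r| ≤ M * (w s / 2) := by
    intro s hs
    have h1 : |∫ r in (0 : ℝ)..s, l r * u r| ≤ |∫ r in (0 : ℝ)..s, M * (l r * w r)| := by
      rw [← Real.norm_eq_abs]
      apply intervalIntegral.norm_integral_le_abs_of_norm_le
      · filter_upwards [ae_restrict_mem measurableSet_uIoc] with r hr
        have hr' : |r| ≤ T := by
          rcases le_total 0 s with h | h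
          · rw [uIoc_of_le h] at hr; rw [abs_of_pos hr.1]
            exact hr.2.trans ((le_abs_self s).trans hs)
          · rw [uIoc_of_ge h] at hr; rw [abs_of_nonpos hr.2]
            linarith [hr.1, neg_abs_le s]
        rw [Real.norm_eq_abs, abs_of_nonneg (mul_nonneg (h0 _) (hu0 _))]
        have := mul_le_mul_of_nonneg_left (hle r hr') (h0 r)
        linarith
      · exact (hl.toIntervalIntegrable.mul_continuousOn hwc.continuousOn).const_mul M
    refine h1.trans ?_
    rw [intervalIntegral.integral_const_mul, abs_mul, abs_of_nonneg hM0]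
    exact mul_le_mul_of_nonneg_left (abs_integral_mul_exp_le hl h0 s) hM0
  -- At the maximum point M w ≤ ε + M w / 2, and w ≥ 1.
  have hM2 : M ≤ 2 * ε := by
    have hs₀' : |s₀| ≤ T := abs_le.2 hs₀
    have h1 := h s₀ hs₀'
    have h2 := hint s₀ hs₀'
    have h3 : u s₀ = M * w s₀ := by rw [hM]; field_simp [(hwpos s₀).ne']
    have h4 : M * w s₀ ≤ 2 * ε := by linarith
    nlinarith [hw1 s₀]
  exact (hle t ht).trans (mul_le_mul_of_nonneg_right hM2 (hwpos t).le)

end Gronwall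

/-! ### Linear Carathéodory systems: existence, uniqueness, basic identities -/

section Linear

lemma locallyIntegrable_mul_continuous {R : Type*} [NormedRing R] {A Φ : ℝ → R} (hA : LocallyIntegrable A)
    (hΦ : Continuous Φ) : LocallyIntegrable fun s => A s * Φ s := by
  rw [locallyIntegrable_iff]
  intro k hk
  exact (hA.integrableOn_isCompact hk).mul_continuousOn hΦ.continuousOn hk

variable {R : Type*} [NormedRing R] [NormedAlgebra ℝ R]

/-- `Φ` solves `Φ' = A Φ`, `Φ(0) = 1` in the Carathéodory sense. -/
def IsPrincipal (A Φ : ℝ → R) : Prop :=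
  Continuous Φ ∧ ∀ t, Φ t = 1 + ∫ s in (0 : ℝ)..t, A s * Φ s

/-- Writing Φ = w Ψ with the Grönwall weight w makes the integral operator a contraction of ratio
1/2 on bounded continuous Ψ over the whole line, so one fixed point gives a global solution and no
local pieces need gluing. -/
lemma exists_isPrincipal [CompleteSpace R] {A : ℝ → R} (hA : LocallyIntegrable A) :
    ∃ Φ, IsPrincipal A Φ := by
  set l : ℝ → ℝ := fun t => ‖A t‖ with hl
  have hli : LocallyIntegrable l := hA.toNorm
  set w : ℝ → ℝ := fun s => Real.exp (2 * |∫ u in (0 : ℝ)..s, l u|) with hw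
  have hwc : Continuous w := by
    have := continuous_integral_of_locallyIntegrable hli
    fun_prop
  have hwpos : ∀ s, 0 < w s := fun s => Real.exp_pos _
  have hw1 : ∀ s, 1 ≤ w s := fun s => Real.one_le_exp (by positivity)
  have hloc : ∀ Ψ : ℝ → R, Continuous Ψ → LocallyIntegrable fun s => A s * (w s • Ψ s) :=
    fun Ψ hΨ => locallyIntegrable_mul_continuous hA (hwc.smul hΨ)
  have hbound : ∀ (Ψ : BoundedContinuousFunction ℝ R) (t : ℝ),
      ‖∫ s in (0 : ℝ)..t, A s * (w s • Ψ s)‖ ≤ ‖Ψ‖ * (w t / 2) := by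
    intro Ψ t
    have h1 : ‖∫ s in (0 : ℝ)..t, A s * (w s • Ψ s)‖ ≤
        |∫ s in (0 : ℝ)..t, ‖Ψ‖ * (l s * w s)| := by
      apply intervalIntegral.norm_integral_le_abs_of_norm_le
      · filter_upwards with s
        refine (norm_mul_le _ _).trans ?_
        rw [norm_smul, Real.norm_eq_abs, abs_of_pos (hwpos s)]
        have := Ψ.norm_coe_le_norm s
        have h3 : 0 ≤ ‖A s‖ * w s := mul_nonneg (norm_nonneg _) (hwpos s).le
        simp only [hl]
        nlinarith
      · exact (hli.toIntervalIntegrable.mul_continuousOn hwc.continuousOn).const_mul _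
    refine h1.trans ?_
    rw [intervalIntegral.integral_const_mul, abs_mul, abs_of_nonneg (norm_nonneg _)]
    exact mul_le_mul_of_nonneg_left
      (abs_integral_mul_exp_le hli (fun _ => norm_nonneg _) t) (norm_nonneg _)
  let T : BoundedContinuousFunction ℝ R → BoundedContinuousFunction ℝ R := fun Ψ =>
    BoundedContinuousFunction.ofNormedAddCommGroup
      (fun t => (w t)⁻¹ • (1 + ∫ s in (0 : ℝ)..t, A s * (w s • Ψ s)))
      ((hwc.inv₀ fun s => (hwpos s).ne').smul (continuous_const.add
        (continuous_integral_of_locallyIntegrable (hloc Ψ Ψ.continuous))))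
      (‖(1 : R)‖ + ‖Ψ‖) (by
        intro t
        rw [norm_smul, norm_inv, Real.norm_eq_abs, abs_of_pos (hwpos t),
          inv_mul_le_iff₀ (hwpos t)]
        refine (norm_add_le _ _).trans ?_
        have := hbound Ψ t
        nlinarith [norm_nonneg (1 : R), norm_nonneg Ψ, hw1 t])
  have hT : ContractingWith (1 / 2) T := by
    refine ⟨by rw [← NNReal.coe_lt_coe]; norm_num, LipschitzWith.of_dist_le_mul fun Ψ₁ Ψ₂ => ?_⟩
    rw [dist_eq_norm, dist_eq_norm]
    refine BoundedContinuousFunction.norm_le (by positivity) |>.2 fun t => ?_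
    have heq : (T Ψ₁ - T Ψ₂) t = (w t)⁻¹ • ∫ s in (0 : ℝ)..t, A s * (w s • (Ψ₁ - Ψ₂) s) := by
      simp only [BoundedContinuousFunction.sub_apply, smul_sub, mul_sub]
      rw [intervalIntegral.integral_sub (hloc Ψ₁ Ψ₁.continuous).toIntervalIntegrable
        (hloc Ψ₂ Ψ₂.continuous).toIntervalIntegrable]
      simp only [T, BoundedContinuousFunction.coe_ofNormedAddCommGroup]
      rw [← smul_sub, add_sub_add_left_eq_sub]
    rw [heq, norm_smul, norm_inv, Real.norm_eq_abs, abs_of_pos (hwpos t),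
      inv_mul_le_iff₀ (hwpos t)]
    refine (hbound _ t).trans (le_of_eq ?_)
    push_cast
    ring
  obtain ⟨Ψ, hΨ⟩ : ∃ Ψ, T Ψ = Ψ := ⟨_, hT.fixedPoint_isFixedPt⟩
  refine ⟨fun t => w t • Ψ t, hwc.smul Ψ.continuous, fun t => ?_⟩
  have : Ψ t = (w t)⁻¹ • (1 + ∫ s in (0 : ℝ)..t, A s * (w s • Ψ s)) := by
    conv_lhs => rw [← hΨ]
    rfl
  simp only
  conv_lhs => rw [this]
  rw [smul_inv_smul₀ (hwpos t).ne']

lemma linear_unique {A Φ Ψ : ℝ → R} {c : R} (hA : LocallyIntegrable A) (hΦ : Continuous Φ)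
    (hΨ : Continuous Ψ) (h1 : ∀ t, Φ t = c + ∫ s in (0 : ℝ)..t, A s * Φ s)
    (h2 : ∀ t, Ψ t = c + ∫ s in (0 : ℝ)..t, A s * Ψ s) : Φ = Ψ := by
  funext t
  have key := gronwall_abs (l := fun s => ‖A s‖) (u := fun s => ‖Φ s - Ψ s‖) (ε := 0) (T := |t|)
    hA.toNorm (fun _ => norm_nonneg _) (hΦ.sub hΨ).norm (fun _ => norm_nonneg _) ?_ (le_refl |t|)
  · rw [mul_zero, zero_mul] at key
    exact sub_eq_zero.1 (norm_le_zero_iff.1 key)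
  · intro s _
    have : Φ s - Ψ s = ∫ r in (0 : ℝ)..s, A r * (Φ r - Ψ r) := by
      simp only [mul_sub]
      rw [intervalIntegral.integral_sub
        (locallyIntegrable_mul_continuous hA hΦ).toIntervalIntegrable
        (locallyIntegrable_mul_continuous hA hΨ).toIntervalIntegrable, h1 s, h2 s]
      abel
    simp only [this, zero_add]
    apply intervalIntegral.norm_integral_le_abs_of_norm_le
    · filter_upwards with r
      exact norm_mul_le _ _
    · exact (locallyIntegrable_mul_continuous hA.toNorm (hΦ.sub hΨ).norm).toIntervalIntegrable

lemma IsPrincipal.mul_const [CompleteSpace R] {A Φ : ℝ → R} (h : IsPrincipal A Φ)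
    (hA : LocallyIntegrable A) (C : R) (t : ℝ) :
    Φ t * C = C + ∫ s in (0 : ℝ)..t, A s * (Φ s * C) := by
  have hcst := ((ContinuousLinearMap.mul ℝ R).flip C).intervalIntegral_comp_comm (μ := volume)
    ((locallyIntegrable_mul_continuous hA h.1).toIntervalIntegrable (a := 0) (b := t))
  simp only [ContinuousLinearMap.flip_apply, ContinuousLinearMap.mul_apply'] at hcst
  simp only [← mul_assoc]
  rw [hcst, h.2 t, add_mul, one_mul]

lemma IsPrincipal.eq_add_integral {A Φ : ℝ → R} (h : IsPrincipal A Φ)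
    (hA : LocallyIntegrable A) (s t : ℝ) :
    Φ t = Φ s + ∫ u in s..t, A u * Φ u := by
  have hi := fun a b => (locallyIntegrable_mul_continuous hA h.1).toIntervalIntegrable
    (a := a) (b := b)
  rw [h.2 t, h.2 s, add_assoc, intervalIntegral.integral_add_adjacent_intervals (hi _ _) (hi _ _)]

end Linear

/-! ### Linear systems under weak convergence of the coefficients -/

section WeakConvergence

/-- Cut off steps of length δ from the left, truncating at b; at most K steps are needed. -/
lemma integral_le_of_forall_short {l : ℝ → ℝ} (hl : LocallyIntegrable l) {δ ε : ℝ} (hδ : 0 < δ)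
    (K : ℕ) : ∀ a b : ℝ, a ≤ b → b - a ≤ K * δ →
      (∀ s t, a ≤ s → s ≤ t → t ≤ b → t - s ≤ δ → ∫ u in s..t, l u ≤ ε) →
      ∫ u in a..b, l u ≤ K * ε := by
  induction K with
  | zero =>
    intro a b hab hK _
    have : a = b := by simp at hK; linarith
    simp [this]
  | succ K ih =>
    intro a b hab hK h
    set c := min b (a + δ) with hc
    have hcb : c ≤ b := min_le_left _ _
    have hac : a ≤ c := le_min hab (by linarith)
    have h1 := h a c le_rfl hac hcb (by have := min_le_right b (a + δ); linarith)
    have h2 := ih c b hcb (by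
      push_cast at hK
      rcases min_choice b (a + δ) with h' | h' <;> rw [hc, h']
      · rw [sub_self]; positivity
      · linarith) fun s t hs hst ht => h s t (hac.trans hs) hst ht
    rw [← intervalIntegral.integral_add_adjacent_intervals (b := c) hl.toIntervalIntegrable
      hl.toIntervalIntegrable]
    push_cast
    linarith

lemma exists_forall_short_integral_norm_le {E : Type*} [NormedAddCommGroup E] {A : ℝ → E}
    (hA : LocallyIntegrable A) (r : ℝ) {ε : ℝ} (hε : 0 < ε) :
    ∃ δ > 0, ∀ s t, -r ≤ s → s ≤ t → t ≤ r → t - s ≤ δ → ∫ u in s..t, ‖A u‖ ≤ ε := by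
  have hc := continuous_integral_of_locallyIntegrable hA.toNorm
  have huc := (isCompact_Icc (a := -r) (b := r)).uniformContinuousOn_of_continuous hc.continuousOn
  obtain ⟨δ, hδ, h⟩ := Metric.uniformContinuousOn_iff.1 huc ε hε
  refine ⟨δ / 2, by positivity, fun s t hs hst ht hd => ?_⟩
  have h1 := h t ⟨hs.trans hst, ht⟩ s ⟨hs, hst.trans ht⟩
    (by rw [Real.dist_eq, abs_of_nonneg (by linarith)]; linarith)
  rw [Real.dist_eq] at h1
  have h2 := intervalIntegral.integral_add_adjacent_intervals (a := 0) (b := s) (c := t)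
    hA.toNorm.toIntervalIntegrable hA.toNorm.toIntervalIntegrable
  linarith [(abs_lt.1 h1).2]

lemma integral_norm_le_add {E : Type*} [NormedAddCommGroup E] {A B C : ℝ → E}
    (hA : LocallyIntegrable A) (hB : LocallyIntegrable B) (hC : LocallyIntegrable C) {s t : ℝ}
    (hst : s ≤ t) (h : ∀ u, ‖A u‖ ≤ ‖B u‖ + ‖C u‖) :
    ∫ u in s..t, ‖A u‖ ≤ (∫ u in s..t, ‖B u‖) + ∫ u in s..t, ‖C u‖ := by
  rw [← intervalIntegral.integral_add hB.toNorm.toIntervalIntegrable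
    hC.toNorm.toIntervalIntegrable]
  exact intervalIntegral.integral_mono hst hA.toNorm.toIntervalIntegrable
    (hB.toNorm.add hC.toNorm).toIntervalIntegrable h

/-- Eventual equi-integrability on bounded intervals along a filter. -/
def EventuallyEquiintegrable {ι E : Type*} [NormedAddCommGroup E] (F : Filter ι)
    (A : ι → ℝ → E) : Prop :=
  ∀ r : ℝ, ∀ ε > 0, ∃ δ > 0, ∀ᶠ n in F, ∀ s t, -r ≤ s → s ≤ t → t ≤ r → t - s ≤ δ →
    ∫ u in s..t, ‖A n u‖ ≤ ε

lemma EventuallyEquiintegrable.sub {ι E : Type*} [NormedAddCommGroup E] {F : Filter ι}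
    {A : ι → ℝ → E} {B : ℝ → E} (h : EventuallyEquiintegrable F A)
    (hA : ∀ᶠ n in F, LocallyIntegrable (A n)) (hB : LocallyIntegrable B) :
    EventuallyEquiintegrable F fun n s => A n s - B s := by
  intro r ε hε
  obtain ⟨δ₁, hδ₁, h₁⟩ := h r (ε / 2) (by positivity)
  obtain ⟨δ₂, hδ₂, h₂⟩ := exists_forall_short_integral_norm_le hB r (half_pos hε)
  refine ⟨min δ₁ δ₂, lt_min hδ₁ hδ₂, ?_⟩
  filter_upwards [h₁, hA] with n hn hAn s t hs hst ht hd
  have e1 := hn s t hs hst ht (hd.trans (min_le_left _ _))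
  have e2 := h₂ s t hs hst ht (hd.trans (min_le_right _ _))
  have := integral_norm_le_add (hAn.sub hB) hAn hB hst fun u => norm_sub_le _ _
  exact this.trans (by linarith)

lemma EventuallyEquiintegrable.exists_bound {ι E : Type*} [NormedAddCommGroup E] {F : Filter ι}
    {A : ι → ℝ → E} (h : EventuallyEquiintegrable F A) (hA : ∀ᶠ n in F, LocallyIntegrable (A n))
    (r : ℝ) :
    ∃ C : ℝ, 0 ≤ C ∧ ∀ᶠ n in F, ∀ s t, -r ≤ s → s ≤ t → t ≤ r → ∫ u in s..t, ‖A n u‖ ≤ C := by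
  obtain ⟨δ, hδ, h1⟩ := h r 1 one_pos
  refine ⟨⌈2 * r / δ⌉₊, by positivity, ?_⟩
  filter_upwards [h1, hA] with n hn hAn s t hs hst ht
  have := integral_le_of_forall_short hAn.toNorm hδ ⌈2 * r / δ⌉₊ s t hst
    (by
      have := Nat.le_ceil (2 * r / δ)
      rw [div_le_iff₀ hδ] at this
      linarith) fun s' t' h1 h2 h3 => hn s' t' (hs.trans h1) h2 (h3.trans ht)
  simpa using this

variable {R : Type*} [NormedRing R] [NormedAlgebra ℝ R] [CompleteSpace R]

/-- Freeze Ψ at the left node of each cell. The oscillation of Ψ costs η ∫ ‖D‖, and the frozen value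
factors out of the integral, leaving at most γ M per cell. -/
lemma norm_integral_mul_grid_le {D Ψ : ℝ → R} (hD : LocallyIntegrable D) (hΨ : Continuous Ψ)
    {a δ M η γ : ℝ} (hδ : 0 < δ) (k : ℕ)
    (hosc : ∀ i < k, ∀ s ∈ Icc (a + i * δ) (a + (i + 1) * δ), ‖Ψ s - Ψ (a + i * δ)‖ ≤ η)
    (hM : ∀ i < k, ‖Ψ (a + i * δ)‖ ≤ M) (hγ0 : 0 ≤ γ)
    (hγ : ∀ i < k, ‖∫ s in (a + i * δ)..(a + (i + 1) * δ), D s‖ ≤ γ) :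
    ‖∫ s in a..(a + k * δ), D s * Ψ s‖ ≤
      η * (∫ s in a..(a + k * δ), ‖D s‖) + k * (γ * M) := by
  induction k with
  | zero => simp
  | succ k ih =>
    have ih' := ih (fun i hi => hosc i (by omega)) (fun i hi => hM i (by omega))
      (fun i hi => hγ i (by omega))
    have hDΨ := locallyIntegrable_mul_continuous hD hΨ
    have hle : a + (k : ℝ) * δ ≤ a + (k + 1) * δ := by nlinarith
    push_cast
    rw [← intervalIntegral.integral_add_adjacent_intervals (b := a + k * δ)
      hDΨ.toIntervalIntegrable hDΨ.toIntervalIntegrable,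
      ← intervalIntegral.integral_add_adjacent_intervals (b := a + k * δ)
      hD.toNorm.toIntervalIntegrable hD.toNorm.toIntervalIntegrable]
    have hsplit : ∫ s in (a + k * δ)..(a + (k + 1) * δ), D s * Ψ s =
        (∫ s in (a + k * δ)..(a + (k + 1) * δ), D s * (Ψ s - Ψ (a + k * δ))) +
        (∫ s in (a + k * δ)..(a + (k + 1) * δ), D s) * Ψ (a + k * δ) := by
      have hcst := ((ContinuousLinearMap.mul ℝ R).flip
        (Ψ (a + k * δ))).intervalIntegral_comp_comm (μ := volume)
        (hD.toIntervalIntegrable (a := a + k * δ) (b := a + (k + 1) * δ))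
      simp only [ContinuousLinearMap.flip_apply, ContinuousLinearMap.mul_apply'] at hcst
      rw [← hcst]
      simp only [mul_sub]
      rw [intervalIntegral.integral_sub hDΨ.toIntervalIntegrable
        (locallyIntegrable_mul_continuous hD continuous_const).toIntervalIntegrable]
      abel
    have h1 : ‖∫ s in (a + k * δ)..(a + (k + 1) * δ), D s * (Ψ s - Ψ (a + k * δ))‖ ≤
        η * ∫ s in (a + k * δ)..(a + (k + 1) * δ), ‖D s‖ := by
      rw [← intervalIntegral.integral_const_mul]
      apply intervalIntegral.norm_integral_le_of_norm_le hle
      · filter_upwards with s hs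
        refine (norm_mul_le _ _).trans ?_
        rw [mul_comm]
        exact mul_le_mul_of_nonneg_right (hosc k (by omega) s ⟨hs.1.le, hs.2⟩) (norm_nonneg _)
      · exact hD.toNorm.toIntervalIntegrable.const_mul _
    have h2 : ‖(∫ s in (a + k * δ)..(a + (k + 1) * δ), D s) * Ψ (a + k * δ)‖ ≤ γ * M :=
      (norm_mul_le _ _).trans (mul_le_mul (hγ k (by omega)) (hM k (by omega)) (norm_nonneg _) hγ0)
    rw [hsplit]
    refine (norm_add_le _ _).trans ?_
    have h3 := norm_add_le (∫ s in (a + k * δ)..(a + (k + 1) * δ), D s * (Ψ s - Ψ (a + k * δ)))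
      ((∫ s in (a + k * δ)..(a + (k + 1) * δ), D s) * Ψ (a + k * δ))
    linarith

/-- Weak convergence to zero on rational intervals, together with equi-integrability, gives
uniform smallness of the primitives against a fixed continuous function. -/
lemma eventually_norm_integral_mul_le {ι : Type*} {F : Filter ι} {D : ι → ℝ → R} {Ψ : ℝ → R}
    (hD : ∀ᶠ n in F, LocallyIntegrable (D n)) (hΨ : Continuous Ψ)
    (h1 : ∀ p q : ℚ, p ≤ q → Tendsto (fun n => ∫ s in (p : ℝ)..q, D n s) F (𝓝 0))
    (h2 : EventuallyEquiintegrable F D) (r : ℝ) {ε : ℝ} (hε : 0 < ε) :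
    ∀ᶠ n in F, ∀ t, |t| ≤ r → ‖∫ s in (0 : ℝ)..t, D n s * Ψ s‖ ≤ ε := by
  obtain ⟨N, hN⟩ := exists_nat_ge r
  -- Integrating from −N lets a single left-to-right grid serve both signs of t; the original
  -- integral is a difference of two such.
  suffices h : ∀ ε > 0, ∀ᶠ n in F, ∀ t, -(N : ℝ) ≤ t → t ≤ N →
      ‖∫ s in (-(N : ℝ))..t, D n s * Ψ s‖ ≤ ε by
    filter_upwards [h (ε / 2) (half_pos hε), hD] with n hn hDn t ht
    have hDΨ := locallyIntegrable_mul_continuous hDn hΨ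
    rw [← intervalIntegral.integral_interval_sub_left (a := -(N : ℝ))
      hDΨ.toIntervalIntegrable hDΨ.toIntervalIntegrable]
    refine (norm_sub_le _ _).trans ?_
    have := abs_le.1 ht
    have e1 := hn t (by linarith) (by linarith)
    have e2 := hn 0 (by simp) (by simp)
    linarith
  intro ε hε
  obtain ⟨C, hC0, hC⟩ := h2.exists_bound hD N
  obtain ⟨M, hM⟩ := (isCompact_Icc (a := -(N : ℝ)) (b := N)).exists_bound_of_continuousOn
    hΨ.continuousOn
  set M' := max M 1
  have hM' : ∀ s ∈ Icc (-(N : ℝ)) N, ‖Ψ s‖ ≤ M' := fun s hs => (hM s hs).trans (le_max_left _ _)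
  have hM'0 : 0 < M' := lt_of_lt_of_le one_pos (le_max_right _ _)
  set η := ε / (3 * (C + 1))
  have hη : 0 < η := by positivity
  have huc := (isCompact_Icc (a := -(N : ℝ)) (b := N)).uniformContinuousOn_of_continuous
    hΨ.continuousOn
  obtain ⟨δ₁, hδ₁, hosc⟩ := Metric.uniformContinuousOn_iff.1 huc η hη
  obtain ⟨δ₂, hδ₂, hsh⟩ := h2 N (ε / (3 * M')) (by positivity)
  -- A rational mesh makes all nodes rational, and a finite number of them serves every t at once.
  -- The constants η, γ and the choice of δ₂ each cost ε / 3: oscillation, frozen terms, last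
  -- incomplete cell.
  obtain ⟨δ, hδ0, hδ⟩ := exists_rat_btwn (lt_min hδ₁ hδ₂)
  have hδ0' : (0 : ℚ) < δ := by exact_mod_cast hδ0
  set K := ⌈2 * (N : ℝ) / δ⌉₊
  set γ := ε / (3 * M' * (K + 1))
  have hγ : 0 < γ := by positivity
  have hnodes : ∀ᶠ n in F, ∀ i ∈ Finset.range K,
      ‖∫ s in (-(N : ℝ) + i * δ)..(-(N : ℝ) + (i + 1) * δ), D n s‖ ≤ γ := by
    rw [Filter.eventually_all_finset]
    intro i _
    have := h1 (-N + i * δ) (-N + (i + 1) * δ) (by nlinarith)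
    push_cast at this
    filter_upwards [this.norm.eventually_le_const (u := γ) (by simpa using hγ)] with n hn
    exact hn
  filter_upwards [hC, hsh, hnodes, hD] with n hCn hshn hnn hDn t ht1 ht2
  set k := ⌊(t + N) / δ⌋₊
  have hk1 : (k : ℝ) * δ ≤ t + N := by
    rw [← le_div_iff₀ hδ0]; exact Nat.floor_le (div_nonneg (by linarith) hδ0.le)
  have hk2 : t + N < (k + 1) * δ := by
    rw [← div_lt_iff₀ hδ0]; exact Nat.lt_floor_add_one _
  have hkK : k ≤ K := by
    have : (k : ℝ) ≤ K := by
      refine le_trans ?_ (Nat.le_ceil _)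
      rw [le_div_iff₀ hδ0]; linarith
    exact_mod_cast this
  have hi : ∀ i < k, -(N : ℝ) + (i + 1) * δ ≤ N := by
    intro i hi
    have : (i : ℝ) + 1 ≤ k := by exact_mod_cast hi
    nlinarith
  have hmem : ∀ i < k, -(N : ℝ) + i * δ ∈ Icc (-(N : ℝ)) N := by
    intro i hik
    have := hi i hik
    constructor
    · have : (0 : ℝ) ≤ i * δ := by positivity
      linarith
    · linarith
  have hgrid := norm_integral_mul_grid_le hDn hΨ (a := -(N : ℝ)) (δ := δ) (M := M') (η := η)
    (γ := γ) hδ0 k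
    (by
      intro i hik s hs
      have h1 := hmem i hik
      have h2 := hi i hik
      refine (hosc s ⟨h1.1.trans hs.1, hs.2.trans h2⟩ _ h1 ?_).le.trans' (dist_eq_norm _ _).ge
      rw [Real.dist_eq, abs_of_nonneg (by linarith [hs.1])]
      have := hδ.trans_le (min_le_left _ _)
      linarith [hs.2])
    (fun i hik => hM' _ (hmem i hik)) hγ.le
    (fun i hik => hnn i (Finset.mem_range.2 (by omega)))
  have hDΨ := locallyIntegrable_mul_continuous hDn hΨ
  have hq1 : -(N : ℝ) ≤ -(N : ℝ) + k * δ := by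
    have : (0 : ℝ) ≤ k * δ := by positivity
    linarith
  rw [← intervalIntegral.integral_add_adjacent_intervals (b := -(N : ℝ) + k * δ)
    hDΨ.toIntervalIntegrable hDΨ.toIntervalIntegrable]
  have hrem : ‖∫ s in (-(N : ℝ) + k * δ)..t, D n s * Ψ s‖ ≤
      M' * ∫ s in (-(N : ℝ) + k * δ)..t, ‖D n s‖ := by
    rw [← intervalIntegral.integral_const_mul]
    apply intervalIntegral.norm_integral_le_of_norm_le (by linarith)
    · filter_upwards with s hs
      refine (norm_mul_le _ _).trans ?_
      rw [mul_comm]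
      exact mul_le_mul_of_nonneg_right (hM' s ⟨hq1.trans hs.1.le, hs.2.trans ht2⟩) (norm_nonneg _)
    · exact hDn.toNorm.toIntervalIntegrable.const_mul _
  have hrem2 := hshn (-(N : ℝ) + k * δ) t hq1 (by linarith) ht2
    (by have := hδ.trans_le (min_le_right _ _); linarith)
  have hC2 := hCn (-(N : ℝ)) (-(N : ℝ) + k * δ) le_rfl hq1 (by linarith)
  refine (norm_add_le _ _).trans ?_
  have e1 : η * ∫ s in (-(N : ℝ))..(-(N : ℝ) + k * δ), ‖D n s‖ ≤ ε / 3 := by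
    calc _ ≤ η * (C + 1) := mul_le_mul_of_nonneg_left (by linarith) hη.le
      _ = ε / 3 := by simp only [η]; field_simp
  have e2 : (k : ℝ) * (γ * M') ≤ ε / 3 := by
    have : (k : ℝ) ≤ K + 1 := by have : (k : ℝ) ≤ K := by exact_mod_cast hkK
                                 linarith
    calc _ ≤ ((K : ℝ) + 1) * (γ * M') := mul_le_mul_of_nonneg_right this (by positivity)
      _ = ε / 3 := by simp only [γ]; field_simp
  have e3 : M' * ∫ s in (-(N : ℝ) + k * δ)..t, ‖D n s‖ ≤ ε / 3 := by
    calc _ ≤ M' * (ε / (3 * M')) := mul_le_mul_of_nonneg_left hrem2 hM'0.le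
      _ = ε / 3 := by field_simp
  linarith

/-- Continuous dependence of principal solutions under weak convergence of equi-integrable
coefficients. -/
lemma tendsto_isPrincipal {ι : Type*} {F : Filter ι} {A : ι → ℝ → R} {B : ℝ → R}
    {Φ : ι → ℝ → R} {Ψ : ℝ → R} (hA : ∀ᶠ n in F, LocallyIntegrable (A n))
    (hB : LocallyIntegrable B) (hΦ : ∀ᶠ n in F, IsPrincipal (A n) (Φ n)) (hΨ : IsPrincipal B Ψ)
    (h1 : ∀ p q : ℚ, p ≤ q →
      Tendsto (fun n => ∫ s in (p : ℝ)..q, A n s) F (𝓝 (∫ s in (p : ℝ)..q, B s)))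
    (h2 : EventuallyEquiintegrable F A) (t : ℝ) :
    Tendsto (fun n => Φ n t) F (𝓝 (Ψ t)) := by
  obtain ⟨C, hC0, hC⟩ := h2.exists_bound hA |t|
  have hD1 : ∀ p q : ℚ, p ≤ q →
      Tendsto (fun n => ∫ s in (p : ℝ)..q, (A n s - B s)) F (𝓝 0) := by
    intro p q hpq
    have := (h1 p q hpq).sub_const (∫ s in (p : ℝ)..q, B s)
    rw [sub_self] at this
    refine this.congr' ?_
    filter_upwards [hA] with n hn
    rw [intervalIntegral.integral_sub hn.toIntervalIntegrable hB.toIntervalIntegrable]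
  have hDl : ∀ᶠ n in F, LocallyIntegrable fun s => A n s - B s := by
    filter_upwards [hA] with n hn using hn.sub hB
  rw [Metric.tendsto_nhds]
  intro ε hε
  -- Grönwall multiplies the error by at most 2 exp(2C), which leaves ε / 2.
  set ε' := ε / (4 * Real.exp (2 * C))
  have hε' : 0 < ε' := by positivity
  filter_upwards [hA, hΦ, hC, eventually_norm_integral_mul_le hDl hΨ.1 hD1 (h2.sub hA hB)
    |t| hε'] with n hAn hΦn hCn hEn
  have hg := gronwall_abs (l := fun s => ‖A n s‖) (u := fun s => ‖Φ n s - Ψ s‖) (ε := ε')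
    (T := |t|) hAn.toNorm (fun _ => norm_nonneg _) (hΦn.1.sub hΨ.1).norm (fun _ => norm_nonneg _)
    ?_ le_rfl
  · rw [dist_eq_norm]
    refine hg.trans_lt ?_
    have hb : |∫ s in (0 : ℝ)..t, ‖A n s‖| ≤ C := by
      rcases le_total 0 t with h | h
      · rw [abs_of_nonneg (intervalIntegral.integral_nonneg h fun _ _ => norm_nonneg _)]
        exact hCn 0 t (by simp) h (le_abs_self t)
      · rw [intervalIntegral.integral_symm, abs_neg,
          abs_of_nonneg (intervalIntegral.integral_nonneg h fun _ _ => norm_nonneg _)]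
        exact hCn t 0 (neg_abs_le t) h (abs_nonneg t)
    calc 2 * ε' * Real.exp (2 * |∫ s in (0 : ℝ)..t, ‖A n s‖|) ≤ 2 * ε' * Real.exp (2 * C) := by
          gcongr
      _ = ε / 2 := by simp only [ε']; field_simp; norm_num
      _ < ε := by linarith
  · intro s hs
    -- The coefficient error is paired with the fixed function Ψ, where weak convergence applies;
    -- the other term is the one Grönwall absorbs.
    have heq : Φ n s - Ψ s = (∫ u in (0 : ℝ)..s, (A n u - B u) * Ψ u) +
        ∫ u in (0 : ℝ)..s, A n u * (Φ n u - Ψ u) := by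
      simp only [sub_mul, mul_sub]
      rw [intervalIntegral.integral_sub
          (locallyIntegrable_mul_continuous hAn hΨ.1).toIntervalIntegrable
          (locallyIntegrable_mul_continuous hB hΨ.1).toIntervalIntegrable,
        intervalIntegral.integral_sub
          (locallyIntegrable_mul_continuous hAn hΦn.1).toIntervalIntegrable
          (locallyIntegrable_mul_continuous hAn hΨ.1).toIntervalIntegrable, hΦn.2 s, hΨ.2 s]
      abel
    rw [heq]
    refine (norm_add_le _ _).trans (add_le_add (hEn s hs) ?_)
    apply intervalIntegral.norm_integral_le_abs_of_norm_le
    · filter_upwards with u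
      exact norm_mul_le _ _
    · exact (locallyIntegrable_mul_continuous hAn.toNorm (hΦn.1.sub hΨ.1).norm).toIntervalIntegrable

end WeakConvergence

/-! ### Translates, optimal m-bounds and the moduli θ_j -/

section Bounds

variable {N : ℕ} {V : Type*} [NormedAddCommGroup V] [NormedSpace ℝ V]
  [MeasurableSpace V] [BorelSpace V] [SecondCountableTopology V]

lemma Car.shift_apply (τ : ℝ) (f : Car N V) (p : ℝ × Euc N) :
    f.shift τ p = f (p.1 + τ, p.2) := rfl

lemma Car.sub_apply (f g : Car N V) (p : ℝ × Euc N) : (f - g) p = f p - g p := rfl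

lemma Car.shift_shift (f : Car N V) (s t : ℝ) : (f.shift s).shift t = f.shift (t + s) := by
  apply Subtype.ext
  funext p
  change f (p.1 + t + s, p.2) = f (p.1 + (t + s), p.2)
  rw [add_assoc]

lemma Car.shift_zero (f : Car N V) : f.shift 0 = f := by
  apply Subtype.ext
  funext p
  change f (p.1 + 0, p.2) = f p
  rw [add_zero]

lemma Car.integrableOn_comp (f : Car N V) {x : ℝ → Euc N} {a b : ℝ} {j : ℕ}
    (hx : AEMeasurable x (volume.restrict (Icc a b)))
    (hb : ∀ t ∈ Icc a b, x t ∈ Metric.closedBall (0 : Euc N) j) :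
    IntegrableOn (fun t => f (t, x t)) (Icc a b) := by
  obtain ⟨m, hm, hbd⟩ := f.2.2 (Metric.closedBall (0 : Euc N) j) (isCompact_closedBall _ _)
  refine Integrable.mono' (hm.integrableOn_isCompact isCompact_Icc)
    ((f.2.1.comp_aemeasurable (aemeasurable_id.prodMk hx)).aestronglyMeasurable) ?_
  filter_upwards [ae_restrict_of_ae hbd, ae_restrict_mem measurableSet_Icc] with t h1 h2
  exact h1 _ (hb t h2)

lemma Car.intervalIntegrable_comp (f : Car N V) {x : ℝ → Euc N} {a b : ℝ} {j : ℕ} (hab : a ≤ b)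
    (hx : ContinuousOn x (Icc a b))
    (hb : ∀ t ∈ Icc a b, x t ∈ Metric.closedBall (0 : Euc N) j) :
    IntervalIntegrable (fun t => f (t, x t)) volume a b := by
  rw [intervalIntegrable_iff_integrableOn_Icc_of_le hab]
  exact f.integrableOn_comp (hx.aemeasurable measurableSet_Icc) hb

lemma exists_nat_forall_mem_closedBall {x : ℝ → Euc N} (hx : Continuous x) {k : Set ℝ}
    (hk : IsCompact k) : ∃ j : ℕ, ∀ t ∈ k, ‖x t‖ + 1 ≤ j := by
  obtain ⟨C, hC⟩ := hk.exists_bound_of_continuousOn hx.continuousOn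
  obtain ⟨j, hj⟩ := exists_nat_ge (C + 1)
  exact ⟨j, fun t ht => by linarith [hC t ht]⟩

lemma Car.locallyIntegrable_comp (f : Car N V) {x : ℝ → Euc N} (hx : Continuous x) :
    LocallyIntegrable fun t => f (t, x t) := by
  rw [locallyIntegrable_iff]
  intro k hk
  obtain ⟨r, hr⟩ := hk.isBounded.subset_closedBall 0
  rw [Real.closedBall_eq_Icc] at hr
  obtain ⟨j, hj⟩ := exists_nat_forall_mem_closedBall hx (isCompact_Icc (a := 0 - r) (b := 0 + r))
  refine (f.integrableOn_comp (j := j) hx.aemeasurable fun t ht => ?_).mono_set hr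
  rw [mem_closedBall_zero_iff]
  linarith [hj t ht]

/-- The exceptional null set depends on the compact set, so a countable exhaustion by the balls B_j
is used. -/
lemma IsLC.isSC {f : Car N V} (hf : IsLC f) : IsSC f := by
  have h : ∀ j : ℕ, ∀ᵐ t : ℝ, ContinuousOn (fun x => f (t, x)) (Metric.closedBall (0 : Euc N) j) := by
    intro j
    obtain ⟨l, -, hl⟩ := hf _ (isCompact_closedBall (0 : Euc N) (j : ℝ))
    filter_upwards [hl] with t ht
    refine LipschitzOnWith.continuousOn (K := Real.toNNReal |l t|)
      (LipschitzOnWith.of_dist_le_mul fun x hx y hy => ?_)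
    rw [dist_eq_norm, dist_eq_norm, Real.coe_toNNReal _ (abs_nonneg _)]
    exact (ht x hx y hy).trans (mul_le_mul_of_nonneg_right (le_abs_self _) (norm_nonneg _))
  filter_upwards [ae_all_iff.2 h] with t ht
  rw [continuous_iff_continuousAt]
  intro x
  obtain ⟨j, hj⟩ := exists_nat_gt ‖x‖
  exact (ht j).continuousAt (Metric.closedBall_mem_nhds_of_mem (by simpa using hj))

instance (j : ℕ) : Nonempty (Metric.closedBall (0 : Euc N) j) :=
  ⟨⟨0, Metric.mem_closedBall_self (Nat.cast_nonneg j)⟩⟩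

lemma optMBound_nonneg (f : Car N V) (j : ℕ) (t : ℝ) : 0 ≤ optMBound f j t :=
  Real.iSup_nonneg fun _ => norm_nonneg _

lemma ae_le_optMBound (f : Car N V) (j : ℕ) :
    ∀ᵐ t : ℝ, ∀ x ∈ Metric.closedBall (0 : Euc N) j, ‖f (t, x)‖ ≤ optMBound f j t := by
  obtain ⟨m, -, hm⟩ := f.2.2 (Metric.closedBall (0 : Euc N) j) (isCompact_closedBall _ _)
  filter_upwards [hm] with t ht x hx
  refine le_ciSup (f := fun x : Metric.closedBall (0 : Euc N) j => ‖f (t, (x : Euc N))‖) ?_ ⟨x, hx⟩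
  refine ⟨m t, ?_⟩
  rintro _ ⟨y, rfl⟩
  exact ht y y.2

lemma optMBound_le_of_isMBound {f : Car N V} {τ : ℝ} {j : ℕ} {m : ℝ → ℝ}
    (hm : IsMBound (f.shift τ) (Metric.closedBall (0 : Euc N) j) m) :
    ∀ᵐ t : ℝ, optMBound f j (t + τ) ≤ m t := by
  filter_upwards [hm.2] with t ht
  exact ciSup_le fun x => ht x x.2

/-- Continuity in x reduces the uncountable supremum to a countable dense subset of the ball. -/
lemma IsSC.aemeasurable_optMBound {f : Car N V} (hf : IsSC f) (j : ℕ) :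
    AEMeasurable (optMBound f j) := by
  obtain ⟨s, hsc, hsd⟩ := TopologicalSpace.exists_countable_dense (Metric.closedBall (0 : Euc N) j)
  have : Countable s := hsc.to_subtype
  refine ⟨fun t => ⨆ x : s, ‖f (t, ((x : Metric.closedBall (0 : Euc N) j) : Euc N))‖, ?_, ?_⟩
  · refine Measurable.iSup fun x => ?_
    exact (f.2.1.comp (measurable_id.prodMk measurable_const)).norm
  · filter_upwards [hf] with t ht
    exact (hsd.ciSup' (f := fun x : Metric.closedBall (0 : Euc N) j => ‖f (t, (x : Euc N))‖)
      (ht.comp continuous_subtype_val).norm).symm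

lemma IsSC.locallyIntegrable_optMBound {f : Car N V} (hf : IsSC f) (j : ℕ) :
    LocallyIntegrable (optMBound f j) := by
  obtain ⟨m, hm, hb⟩ := f.2.2 (Metric.closedBall (0 : Euc N) j) (isCompact_closedBall _ _)
  refine hm.mono (hf.aemeasurable_optMBound j).aestronglyMeasurable ?_
  have := optMBound_le_of_isMBound (f := f) (τ := 0) (j := j) (m := m)
    (by rw [Car.shift_zero]; exact ⟨hm, hb⟩)
  filter_upwards [this] with t ht
  rw [add_zero] at ht
  rw [Real.norm_eq_abs, abs_of_nonneg (optMBound_nonneg _ _ _)]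
  exact ht.trans (le_abs_self _)

/-- Moving [s, t] to [0, t − s] replaces f by its translate f_s, so equicontinuity on the window
[−1, 1] alone gives a bound uniform over all of ℝ. -/
lemma HasEquicontinuousMBounds.exists_short {f : Car N V} (hS : IsSC f)
    (hf : HasEquicontinuousMBounds f) (j : ℕ) {ε : ℝ} (hε : 0 < ε) :
    ∃ δ > 0, ∀ s t : ℝ, s ≤ t → t - s ≤ δ → ∫ u in s..t, optMBound f j u ≤ ε := by
  obtain ⟨S, hS1, hS2, hS3⟩ := hf j
  obtain ⟨δ, hδ, h⟩ := hS3 1 one_pos ε hε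
  refine ⟨min (δ / 2) 1, by positivity, fun s t hst hd => ?_⟩
  obtain ⟨m, hmS, hm⟩ := hS2 s
  have h1 := h 0 (t - s) (by norm_num) (by linarith) (hd.trans (min_le_right _ _))
    (by linarith [hd.trans (min_le_left _ _)]) m hmS
  refine le_trans ?_ h1.le
  have heq : ∫ u in s..t, optMBound f j u = ∫ u in (0 : ℝ)..(t - s), optMBound f j (u + s) := by
    rw [intervalIntegral.integral_comp_add_right]; simp
  rw [heq]
  refine intervalIntegral.integral_mono_ae (by linarith) ?_ hm.1.toIntervalIntegrable
    (optMBound_le_of_isMBound hm)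
  have := (hS.locallyIntegrable_optMBound j).toIntervalIntegrable (a := s) (b := t)
  simpa using this.comp_add_right s

/-- A nonnegative monotone modulus on `[0, ∞)` that is arbitrarily small at some positive
argument. -/
structure IsModulus (θ : ℝ → ℝ) : Prop where
  nonneg : ∀ s, 0 ≤ s → 0 ≤ θ s
  mono : ∀ s t, 0 ≤ s → s ≤ t → θ s ≤ θ t
  small : ∀ ε > 0, ∃ δ > 0, θ δ ≤ ε

/-- Makes the supremum in `theta` a genuine one: an unbounded real `iSup` would take the default
value 0. -/
lemma bddAbove_integral_optMBound {f : Car N V} (hS : IsSC f)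
    (hf : HasEquicontinuousMBounds f) (j : ℕ) {s : ℝ} (hs : 0 ≤ s) :
    BddAbove (range fun t : ℝ => ∫ u in t..(t + s), optMBound f j u) := by
  obtain ⟨δ, hδ, h⟩ := hf.exists_short hS j one_pos
  refine ⟨⌈s / δ⌉₊ * 1, ?_⟩
  rintro _ ⟨t, rfl⟩
  refine integral_le_of_forall_short (hS.locallyIntegrable_optMBound j) hδ _ t (t + s)
    (by linarith) ?_ fun a b _ hab _ hd => h a b hab hd
  have := Nat.le_ceil (s / δ)
  rw [div_le_iff₀ hδ] at this
  linarith

lemma integral_optMBound_le_theta {f : Car N V} (hS : IsSC f)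
    (hf : HasEquicontinuousMBounds f) (j : ℕ) {a b : ℝ} (hab : a ≤ b) :
    ∫ u in a..b, optMBound f j u ≤ theta f j (b - a) := by
  have := le_ciSup (bddAbove_integral_optMBound hS hf j (sub_nonneg.2 hab)) a
  simp only [add_sub_cancel] at this
  exact this

lemma isModulus_theta {f : Car N V} (hS : IsSC f) (hf : HasEquicontinuousMBounds f) (j : ℕ) :
    IsModulus (theta f j) := by
  have hl := hS.locallyIntegrable_optMBound j
  refine ⟨fun s hs => ?_, fun s t hs hst => ?_, fun ε hε => ?_⟩
  · exact Real.iSup_nonneg fun t => intervalIntegral.integral_nonneg (by linarith)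
      fun u _ => optMBound_nonneg f j u
  · refine ciSup_mono (bddAbove_integral_optMBound hS hf j (hs.trans hst)) fun u => ?_
    exact intervalIntegral.integral_mono_interval le_rfl (by linarith) (by linarith)
      (ae_of_all _ fun v => optMBound_nonneg f j v) hl.toIntervalIntegrable
  · obtain ⟨δ, hδ, h⟩ := hf.exists_short hS j hε
    exact ⟨δ, hδ, ciSup_le fun t => h t (t + δ) (by linarith) (by linarith)⟩

end Bounds

/-! ### Integrals tested on rational intervals and fine partitions -/

section Partition

/-- The breakpoints must be rational because the seminorms only integrate over intervals with
rational endpoints. -/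
lemma exists_rat_partition {p q : ℚ} (hpq : p ≤ q) {δ : ℝ} (hδ : 0 < δ) :
    ∃ (K : ℕ) (a : ℕ → ℚ), Monotone a ∧ a 0 = p ∧ a K = q ∧
      ∀ i, (a (i + 1) : ℝ) - a i < δ := by
  obtain ⟨K, hK⟩ := exists_nat_gt (((q : ℝ) - p) / δ)
  have hpq' : (p : ℝ) ≤ q := by exact_mod_cast hpq
  have hK0 : (0 : ℝ) < K := lt_of_le_of_lt (div_nonneg (by linarith) hδ.le) hK
  have hK0' : (0 : ℚ) < K := by exact_mod_cast hK0
  refine ⟨K, fun i => p + i * ((q - p) / K), fun i j hij => ?_, by simp, ?_, fun i => ?_⟩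
  · have h1 : (i : ℚ) ≤ j := by exact_mod_cast hij
    have h2 : 0 ≤ (q - p) / K := div_nonneg (by linarith) hK0'.le
    simp only
    gcongr
  · field_simp
    ring
  · rw [div_lt_iff₀ hδ] at hK
    push_cast
    have : ((q : ℝ) - p) / K < δ := by
      rw [div_lt_iff₀ hK0]; linarith
    linarith

variable {E : Type*} [NormedAddCommGroup E] [NormedSpace ℝ E]

/-- Primitives are continuous, so p and q may approach the endpoints. Keeping them strictly inside
ensures that whatever is known on [s, t] holds on [p, q]. -/
lemma norm_integral_le_of_rat {A : ℝ → E} {s t C : ℝ} (hst : s < t)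
    (hA : IntervalIntegrable A volume s t)
    (h : ∀ p q : ℚ, s < p → p ≤ q → (q : ℝ) < t → ‖∫ u in (p : ℝ)..q, A u‖ ≤ C) :
    ‖∫ u in s..t, A u‖ ≤ C := by
  have hA' : IntegrableOn A (uIcc s t) := by
    rw [uIcc_of_le hst.le]; exact (intervalIntegrable_iff_integrableOn_Icc_of_le hst.le).1 hA
  have hc := intervalIntegral.continuousOn_primitive_interval (μ := volume) hA'
  rw [uIcc_of_le hst.le] at hc
  refine le_of_forall_pos_le_add fun ε hε => ?_
  obtain ⟨δ₁, hδ₁, h₁⟩ := Metric.continuousOn_iff.1 hc s ⟨le_rfl, hst.le⟩ (ε / 2) (half_pos hε)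
  obtain ⟨δ₂, hδ₂, h₂⟩ := Metric.continuousOn_iff.1 hc t ⟨hst.le, le_rfl⟩ (ε / 2) (half_pos hε)
  obtain ⟨p, hp1, hp2⟩ := exists_rat_btwn
    (show s < min (s + δ₁) ((s + t) / 2) from lt_min (by linarith) (by linarith))
  obtain ⟨q, hq1, hq2⟩ := exists_rat_btwn
    (show max (t - δ₂) ((s + t) / 2) < t from max_lt (by linarith) (by linarith))
  have hp3 := hp2.trans_le (min_le_left _ _)
  have hp4 := hp2.trans_le (min_le_right _ _)
  have hq3 := (le_max_left _ _).trans_lt hq1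
  have hq4 := (le_max_right _ _).trans_lt hq1
  have e1 := h₁ p ⟨hp1.le, by linarith⟩
    (by rw [Real.dist_eq, abs_of_nonneg (by linarith)]; linarith)
  have e2 := h₂ q ⟨by linarith, hq2.le⟩
    (by rw [Real.dist_eq, abs_of_nonpos (by linarith)]; linarith)
  have e3 := h p q hp1 (by exact_mod_cast (show (p : ℝ) ≤ q by linarith)) hq2
  have i1 : IntervalIntegrable A volume s p :=
    hA.mono_set (by rw [uIcc_of_le hst.le, uIcc_of_le hp1.le]; exact Icc_subset_Icc_right (by linarith))
  have i2 : IntervalIntegrable A volume s q :=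
    hA.mono_set (by rw [uIcc_of_le hst.le, uIcc_of_le (by linarith)]
                    exact Icc_subset_Icc_right (by linarith))
  rw [← intervalIntegral.integral_interval_sub_left i2 i1] at e3
  simp only [intervalIntegral.integral_same, dist_eq_norm, sub_zero] at e1 e2
  have e4 : ‖∫ u in s..t, A u‖ ≤ ‖(∫ u in s..(q : ℝ), A u) - ∫ u in s..t, A u‖ +
      (‖(∫ u in s..(q : ℝ), A u) - ∫ u in s..(p : ℝ), A u‖ + ‖∫ u in s..(p : ℝ), A u‖) := by
    have : ∫ u in s..t, A u = -((∫ u in s..(q : ℝ), A u) - ∫ u in s..t, A u) +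
      (((∫ u in s..(q : ℝ), A u) - ∫ u in s..(p : ℝ), A u) + ∫ u in s..(p : ℝ), A u) := by abel
    conv_lhs => rw [this]
    refine (norm_add_le _ _).trans ?_
    rw [norm_neg]
    exact add_le_add_right (norm_add_le _ _) _
  linarith

/-- The total mass of a vector-valued integrable function is controlled by its variation along
arbitrarily fine partitions. -/
lemma integral_norm_le_of_partitions [CompleteSpace E] {A : ℝ → E} {p q C : ℝ} (hpq : p ≤ q)
    (hA : IntegrableOn A (Icc p q))
    (h : ∀ δ > 0, ∃ (K : ℕ) (a : ℕ → ℝ), Monotone a ∧ a 0 = p ∧ a K = q ∧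
      (∀ i, a (i + 1) - a i < δ) ∧
      ∑ i ∈ Finset.range K, ‖∫ u in (a i)..(a (i + 1)), A u‖ ≤ C) :
    ∫ u in p..q, ‖A u‖ ≤ C := by
  refine le_of_forall_pos_le_add fun ε hε => ?_
  have hA' : Integrable ((Icc p q).indicator A) := hA.integrable_indicator measurableSet_Icc
  -- A continuous B is almost constant on a short cell, where the norm of its integral and the
  -- integral of its norm nearly agree. Going from ‖A‖ to B and back to A pays ε / 4 twice, and the
  -- oscillation η twice, for a total of ε.
  obtain ⟨B, -, hB1, hB2, hB3⟩ := hA'.exists_hasCompactSupport_integral_sub_le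
    (show 0 < ε / 4 by positivity)
  set η := ε / (4 * (q - p + 1)) with hη
  have hqp : 0 < q - p + 1 := by linarith
  have hη0 : 0 < η := by positivity
  have huc := (isCompact_Icc (a := p) (b := q)).uniformContinuousOn_of_continuous hB2.continuousOn
  obtain ⟨δ, hδ, hosc⟩ := Metric.uniformContinuousOn_iff.1 huc η hη0
  obtain ⟨K, a, ham, ha0, haK, had, hC⟩ := h δ hδ
  have hsub : ∀ i < K, Icc (a i) (a (i + 1)) ⊆ Icc p q := fun i hi =>
    Icc_subset_Icc (ha0 ▸ ham (Nat.zero_le i)) (haK ▸ ham hi)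
  have hle : ∀ i, a i ≤ a (i + 1) := fun i => ham (Nat.le_succ i)
  have hAi : ∀ i < K, IntervalIntegrable A volume (a i) (a (i + 1)) := fun i hi =>
    (intervalIntegrable_iff_integrableOn_Icc_of_le (hle i)).2 (hA.mono_set (hsub i hi))
  have hBi : ∀ x y, IntervalIntegrable B volume x y := fun x y => hB2.intervalIntegrable x y
  have hAB : ∫ u in p..q, ‖A u - B u‖ ≤ ε / 4 := by
    refine le_trans ?_ hB1
    rw [intervalIntegral.integral_of_le hpq, ← integral_Icc_eq_integral_Ioc]
    refine (setIntegral_congr_fun (g := fun u => ‖(Icc p q).indicator A u - B u‖)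
      measurableSet_Icc fun u hu => ?_).trans_le
      (setIntegral_le_integral (hA'.sub hB3).norm (ae_of_all _ fun u => norm_nonneg _))
    simp only [indicator_of_mem hu]
  have hpiece : ∀ i ∈ Finset.range K, ∫ u in (a i)..(a (i + 1)), ‖A u‖ ≤
      ‖∫ u in (a i)..(a (i + 1)), A u‖ + 2 * (∫ u in (a i)..(a (i + 1)), ‖A u - B u‖) +
        2 * η * (a (i + 1) - a i) := by
    intro i hi
    rw [Finset.mem_range] at hi
    have hd : 0 ≤ a (i + 1) - a i := sub_nonneg.2 (hle i)
    have hai : a i ∈ Icc p q := hsub i hi ⟨le_rfl, hle i⟩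
    have hoscB : ∀ u ∈ Icc (a i) (a (i + 1)), ‖B u - B (a i)‖ ≤ η := by
      intro u hu
      rw [← dist_eq_norm]
      refine (hosc u (hsub i hi hu) _ hai ?_).le
      rw [Real.dist_eq, abs_of_nonneg (by linarith [hu.1])]
      linarith [hu.2, had i]
    have e1 : ∫ u in (a i)..(a (i + 1)), ‖A u‖ ≤
        (∫ u in (a i)..(a (i + 1)), ‖A u - B u‖) + (a (i + 1) - a i) * (‖B (a i)‖ + η) := by
      have : ∫ u in (a i)..(a (i + 1)), (‖B (a i)‖ + η) = (a (i + 1) - a i) * (‖B (a i)‖ + η) := by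
        simp [mul_add]
      rw [← this, ← intervalIntegral.integral_add ((hAi i hi).sub (hBi _ _)).norm (by simp)]
      refine intervalIntegral.integral_mono_on (hle i) (hAi i hi).norm
        (((hAi i hi).sub (hBi _ _)).norm.add (by simp)) fun u hu => ?_
      have h1 : A u = (A u - B u) + ((B u - B (a i)) + B (a i)) := by abel
      have h2 := norm_add_le (A u - B u) ((B u - B (a i)) + B (a i))
      rw [← h1] at h2
      have h3 := norm_add_le (B u - B (a i)) (B (a i))
      have h4 := hoscB u hu
      linarith
    have e2 : (a (i + 1) - a i) * ‖B (a i)‖ ≤ ‖∫ u in (a i)..(a (i + 1)), A u‖ +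
        (∫ u in (a i)..(a (i + 1)), ‖A u - B u‖) + η * (a (i + 1) - a i) := by
      have h0 : (a (i + 1) - a i) * ‖B (a i)‖ = ‖∫ _u in (a i)..(a (i + 1)), B (a i)‖ := by
        rw [intervalIntegral.integral_const, norm_smul, Real.norm_eq_abs, abs_of_nonneg hd]
      have h1 : ∫ _u in (a i)..(a (i + 1)), B (a i) = (∫ u in (a i)..(a (i + 1)), A u) -
          ((∫ u in (a i)..(a (i + 1)), (A u - B u)) +
            ∫ u in (a i)..(a (i + 1)), (B u - B (a i))) := by
        rw [intervalIntegral.integral_sub (hAi i hi) (hBi _ _),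
          intervalIntegral.integral_sub (hBi _ _) (by simp)]
        abel
      have h2 := intervalIntegral.norm_integral_le_integral_norm (μ := volume) (hle i)
        (f := fun u => A u - B u)
      have h3 : ‖∫ u in (a i)..(a (i + 1)), (B u - B (a i))‖ ≤ η * |a (i + 1) - a i| := by
        apply intervalIntegral.norm_integral_le_of_norm_le_const
        intro u hu
        rw [uIoc_of_le (hle i)] at hu
        exact hoscB u ⟨hu.1.le, hu.2⟩
      rw [abs_of_nonneg hd] at h3
      rw [h0, h1]
      have h4 := norm_sub_le (∫ u in (a i)..(a (i + 1)), A u)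
        ((∫ u in (a i)..(a (i + 1)), (A u - B u)) + ∫ u in (a i)..(a (i + 1)), (B u - B (a i)))
      have h5 := norm_add_le (∫ u in (a i)..(a (i + 1)), (A u - B u))
        (∫ u in (a i)..(a (i + 1)), (B u - B (a i)))
      linarith
    linarith
  have hs1 := intervalIntegral.sum_integral_adjacent_intervals (f := fun u => ‖A u‖)
    (μ := volume) (a := a) (n := K) fun i hi => (hAi i hi).norm
  have hs2 := intervalIntegral.sum_integral_adjacent_intervals (f := fun u => ‖A u - B u‖)
    (μ := volume) (a := a) (n := K) fun i hi => ((hAi i hi).sub (hBi _ _)).norm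
  have hs3 := Finset.sum_range_sub a K
  have hsum := Finset.sum_le_sum hpiece
  rw [Finset.sum_add_distrib, Finset.sum_add_distrib, ← Finset.mul_sum, ← Finset.mul_sum,
    hs1, hs2, hs3, ha0, haK] at hsum
  have hlast : 2 * η * (q - p) ≤ ε / 2 := by
    calc 2 * η * (q - p) ≤ 2 * η * (q - p + 1) := by gcongr; linarith
      _ = ε / 2 := by rw [hη]; field_simp; norm_num
  linarith

end Partition

/-! ### Convergence in the two topologies and bounds inherited by limits -/

section Topology

variable {N : ℕ} {V : Type*} [NormedAddCommGroup V] [NormedSpace ℝ V]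
  [MeasurableSpace V] [BorelSpace V] [SecondCountableTopology V]

lemma tendsto_car_iff {α : Type*} {mode : Mode} {Θ : ℕ → ℝ → ℝ} {u : α → Car N V} {l : Filter α}
    {g : Car N V} :
    Tendsto u l (@nhds _ (carTopology mode Θ N V) g) ↔
      ∀ i, ∀ ε > 0, ∀ᶠ a in l, seminorms mode N V Θ i (u a - g) < ε := by
  let _ := carTopology mode Θ N V
  have h : WithSeminorms (seminorms mode N V Θ) := ⟨rfl⟩
  exact h.tendsto_nhds u g

/-- The analogue of `modSet` on an interval with real endpoints. -/
def modOn (N : ℕ) (Θ : ℕ → ℝ → ℝ) (a b : ℝ) (j : ℕ) : Set (ℝ → Euc N) :=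
  {x | ContinuousOn x (Icc a b) ∧ (∀ t ∈ Icc a b, x t ∈ Metric.closedBall (0 : Euc N) j) ∧
    ∀ s ∈ Icc a b, ∀ t ∈ Icc a b, ‖x t - x s‖ ≤ Θ j |t - s|}

lemma modOn_subset {Θ : ℕ → ℝ → ℝ} {a b c d : ℝ} {j : ℕ} (h1 : a ≤ c) (h2 : d ≤ b) :
    modOn N Θ a b j ⊆ modOn N Θ c d j := by
  have h := Icc_subset_Icc h1 h2
  exact fun x hx => ⟨hx.1.mono h, fun t ht => hx.2.1 t (h ht),
    fun s hs t ht => hx.2.2 s (h hs) t (h ht)⟩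

/-- This weak estimate is common to both settings, so the arguments for the vector field need no
case distinction. -/
lemma norm_setIntegral_le_seminorms (mode : Mode) {Θ : ℕ → ℝ → ℝ} (f : Car N V) {q : ℚ × ℚ} {j : ℕ}
    {x : ℝ → Euc N} (hx : x ∈ modSet N Θ q j) :
    ‖∫ t in Icc (q.1 : ℝ) q.2, f (t, x t)‖ ≤ seminorms mode N V Θ (q, j) f := by
  obtain ⟨C, hC⟩ := f.exists_bound Θ q j
  cases mode with
  | strong =>
    refine (norm_integral_le_integral_norm _).trans ?_
    refine le_ciSup (f := fun x : modSet N Θ q j =>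
      ∫ t in Icc (q.1 : ℝ) q.2, ‖f (t, (x : ℝ → Euc N) t)‖) ⟨C, ?_⟩ ⟨x, hx⟩
    rintro _ ⟨y, rfl⟩
    exact (hC y y.2).2
  | weak =>
    refine le_ciSup (f := fun x : modSet N Θ q j =>
      ‖∫ t in Icc (q.1 : ℝ) q.2, f (t, (x : ℝ → Euc N) t)‖) ⟨C, ?_⟩ ⟨x, hx⟩
    rintro _ ⟨y, rfl⟩
    exact (norm_integral_le_integral_norm _).trans (hC y y.2).2

lemma setIntegral_norm_le_seminorms {Θ : ℕ → ℝ → ℝ} (f : Car N V) {q : ℚ × ℚ} {j : ℕ}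
    {x : ℝ → Euc N} (hx : x ∈ modSet N Θ q j) :
    ∫ t in Icc (q.1 : ℝ) q.2, ‖f (t, x t)‖ ≤ seminorms .strong N V Θ (q, j) f := by
  obtain ⟨C, hC⟩ := f.exists_bound Θ q j
  refine le_ciSup (f := fun x : modSet N Θ q j =>
    ∫ t in Icc (q.1 : ℝ) q.2, ‖f (t, (x : ℝ → Euc N) t)‖) ⟨C, ?_⟩ ⟨x, hx⟩
  rintro _ ⟨y, rfl⟩
  exact (hC y y.2).2

lemma norm_integral_le_seminorms (mode : Mode) {Θ : ℕ → ℝ → ℝ} (f : Car N V) {p q : ℚ} {j : ℕ}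
    (hpq : p ≤ q) {x : ℝ → Euc N} (hx : x ∈ modOn N Θ p q j) :
    ‖∫ t in (p : ℝ)..q, f (t, x t)‖ ≤ seminorms mode N V Θ ((p, q), j) f := by
  rw [intervalIntegral.integral_of_le (by exact_mod_cast hpq), ← integral_Icc_eq_integral_Ioc]
  exact norm_setIntegral_le_seminorms mode f (q := (p, q)) hx

lemma tendsto_integral_of_tendsto_car {α : Type*} {mode : Mode} {Θ : ℕ → ℝ → ℝ} {u : α → Car N V}
    {l : Filter α} {g : Car N V} (h : Tendsto u l (@nhds _ (carTopology mode Θ N V) g))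
    {p q : ℚ} (hpq : p ≤ q) {j : ℕ} {x : ℝ → Euc N} (hx : x ∈ modOn N Θ p q j) :
    Tendsto (fun a => ∫ t in (p : ℝ)..q, u a (t, x t)) l (𝓝 (∫ t in (p : ℝ)..q, g (t, x t))) := by
  have hpq' : (p : ℝ) ≤ q := by exact_mod_cast hpq
  rw [tendsto_car_iff] at h
  rw [Metric.tendsto_nhds]
  intro ε hε
  filter_upwards [h ((p, q), j) ε hε] with a ha
  rw [dist_eq_norm, ← intervalIntegral.integral_sub
    ((u a).intervalIntegrable_comp hpq' hx.1 hx.2.1) (g.intervalIntegrable_comp hpq' hx.1 hx.2.1)]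
  exact (norm_integral_le_seminorms mode (u a - g) hpq hx).trans_lt ha

/-- Each cell contributes at most the integral of the optimal m-bound, and these add up over a
translated interval. The curve may change from cell to cell so that it can be replaced by a
piecewise constant one. -/
lemma norm_integral_shift_le_theta {f : Car N V} (hS : IsSC f) (hf : HasEquicontinuousMBounds f)
    (τ : ℝ) {j : ℕ} {a : ℕ → ℝ} (ha : Monotone a) (K : ℕ) {x : ℕ → ℝ → Euc N}
    (hx : ∀ i < K, ∀ t ∈ Icc (a i) (a (i + 1)), x i t ∈ Metric.closedBall (0 : Euc N) j) :
    ∑ i ∈ Finset.range K, ‖∫ t in (a i)..(a (i + 1)), f.shift τ (t, x i t)‖ ≤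
      theta f j (a K - a 0) := by
  have hl := hS.locallyIntegrable_optMBound j
  have hint : ∀ c d, IntervalIntegrable (fun u => optMBound f j (u + τ)) volume c d := by
    intro c d
    have := (hl.toIntervalIntegrable (a := c + τ) (b := d + τ)).comp_add_right τ
    simpa using this
  calc ∑ i ∈ Finset.range K, ‖∫ t in (a i)..(a (i + 1)), f.shift τ (t, x i t)‖
      ≤ ∑ i ∈ Finset.range K, ∫ t in (a i)..(a (i + 1)), optMBound f j (t + τ) := by
        refine Finset.sum_le_sum fun i hi => ?_
        rw [Finset.mem_range] at hi
        refine intervalIntegral.norm_integral_le_of_norm_le (ha (Nat.le_succ i)) ?_ (hint _ _)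
        have mp := measurePreserving_add_right (volume : Measure ℝ) τ
        filter_upwards [mp.quasiMeasurePreserving.ae (ae_le_optMBound f j)] with t ht hti
        exact ht _ (hx i hi t ⟨hti.1.le, hti.2⟩)
    _ = ∫ t in (a 0)..(a K), optMBound f j (t + τ) :=
        intervalIntegral.sum_integral_adjacent_intervals fun _ _ => hint _ _
    _ = ∫ t in (a 0 + τ)..(a K + τ), optMBound f j t := by
        rw [intervalIntegral.integral_comp_add_right]
    _ ≤ theta f j (a K - a 0) := by
        have := integral_optMBound_le_theta hS hf j
          (show a 0 + τ ≤ a K + τ by linarith [ha (Nat.zero_le K)])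
        rwa [add_sub_add_right_eq_sub] at this

/-- Limits of translates inherit the modulus of continuity, along curves in the modulus class. -/
lemma integral_norm_le_theta_of_tendsto [CompleteSpace V] {mode : Mode} {Θ : ℕ → ℝ → ℝ}
    {f G : Car N V}
    (hS : IsSC f) (hf : HasEquicontinuousMBounds f) {l : Filter ℝ} [l.NeBot]
    (h : Tendsto (fun τ => f.shift τ) l (@nhds _ (carTopology mode Θ N V) G))
    {j : ℕ} {s t : ℝ} (hst : s ≤ t) {x : ℝ → Euc N} (hx : x ∈ modOn N Θ s t j) :
    ∫ u in s..t, ‖G (u, x u)‖ ≤ theta f j (t - s) := by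
  have hmod := isModulus_theta hS hf j
  rcases hst.eq_or_lt with rfl | hst
  · simpa using hmod.nonneg 0 le_rfl
  refine (le_abs_self _).trans ?_
  rw [← Real.norm_eq_abs]
  refine norm_integral_le_of_rat hst (G.intervalIntegrable_comp hst.le hx.1 hx.2.1).norm
    fun p q hp hpq hq => ?_
  have hpq' : (p : ℝ) ≤ q := by exact_mod_cast hpq
  have hx' := modOn_subset hp.le hq.le hx
  rw [Real.norm_eq_abs, abs_of_nonneg (intervalIntegral.integral_nonneg hpq'
    fun _ _ => norm_nonneg _)]
  refine le_trans ?_ (hmod.mono (q - p) (t - s) (by linarith) (by linarith))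
  -- Weak convergence controls ‖∫ G‖ on each cell but not ∫ ‖G‖; the partition sums, bounded
  -- uniformly in τ, recover the latter.
  refine integral_norm_le_of_partitions hpq'
    (G.integrableOn_comp (hx'.1.aemeasurable measurableSet_Icc) hx'.2.1) fun δ hδ => ?_
  obtain ⟨K, a, ham, ha0, haK, had⟩ := exists_rat_partition hpq hδ
  have ham' : Monotone fun i => (a i : ℝ) := fun i k hik => Rat.cast_le.2 (ham hik)
  have hsub : ∀ i < K, modOn N Θ p q j ⊆ modOn N Θ (a i) (a (i + 1)) j := by
    intro i hi
    apply modOn_subset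
    · rw [← ha0]; exact_mod_cast ham (Nat.zero_le i)
    · rw [← haK]; exact_mod_cast ham hi
  refine ⟨K, fun i => (a i : ℝ), ham', by simp [ha0], by simp [haK], had, ?_⟩
  have hlim : Tendsto (fun τ => ∑ i ∈ Finset.range K,
      ‖∫ u in (a i : ℝ)..(a (i + 1)), f.shift τ (u, x u)‖) l
      (𝓝 (∑ i ∈ Finset.range K, ‖∫ u in (a i : ℝ)..(a (i + 1)), G (u, x u)‖)) := by
    refine tendsto_finsetSum _ fun i hi => (tendsto_integral_of_tendsto_car h (ham (Nat.le_succ i))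
      (hsub i (Finset.mem_range.1 hi) hx')).norm
  refine le_of_tendsto hlim (Eventually.of_forall fun τ => ?_)
  have := norm_integral_shift_le_theta hS hf τ (j := j) ham' K (x := fun _ => x)
    fun i hi t ht => (hsub i hi hx').2.1 t ht
  simpa only [ha0, haK] using this

/-- Lipschitz limits of translates inherit the modulus of continuity, along all curves. -/
lemma norm_integral_le_theta_of_tendsto {mode : Mode} {Θ : ℕ → ℝ → ℝ}
    {f g : Car N V} (hΘ : ∀ j s, 0 ≤ s → 0 ≤ Θ j s)
    (hS : IsSC f) (hf : HasEquicontinuousMBounds f) {l : Filter ℝ} [l.NeBot]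
    (h : Tendsto (fun τ => f.shift τ) l (@nhds _ (carTopology mode Θ N V) g)) (hg : IsLC g)
    {j : ℕ} {s t : ℝ} (hst : s ≤ t) {x : ℝ → Euc N} (hx : ContinuousOn x (Icc s t))
    (hxj : ∀ u ∈ Icc s t, x u ∈ Metric.closedBall (0 : Euc N) j) :
    ‖∫ u in s..t, g (u, x u)‖ ≤ theta f j (t - s) := by
  have hmod := isModulus_theta hS hf j
  rcases hst.eq_or_lt with rfl | hst
  · simpa using hmod.nonneg 0 le_rfl
  have hgi := g.intervalIntegrable_comp hst.le hx hxj
  refine norm_integral_le_of_rat hst hgi fun p q hp hpq hq => ?_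
  have hpq' : (p : ℝ) ≤ q := by exact_mod_cast hpq
  refine le_trans ?_ (hmod.mono (q - p) (t - s) (by linarith) (by linarith))
  obtain ⟨L, hL, hLip⟩ := hg _ (isCompact_closedBall (0 : Euc N) (j : ℝ))
  have hLi := hL.toNorm
  have hL0 : 0 ≤ ∫ u in (p : ℝ)..q, ‖L u‖ :=
    intervalIntegral.integral_nonneg hpq' fun _ _ => norm_nonneg _
  refine le_of_forall_pos_le_add fun ε hε => ?_
  -- The curve x need not have modulus Θ, so the seminorms do not test it. It is frozen on short
  -- cells, since constants have every nonnegative modulus, and the Lipschitz error is at most η ∫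
  -- ‖L‖ ≤ ε.
  set η := ε / ((∫ u in (p : ℝ)..q, ‖L u‖) + 1) with hη
  have hη0 : 0 < η := by positivity
  have hsub' : Icc (p : ℝ) q ⊆ Icc s t := Icc_subset_Icc hp.le hq.le
  have huc := isCompact_Icc.uniformContinuousOn_of_continuous (hx.mono hsub')
  obtain ⟨δ, hδ, hosc⟩ := Metric.uniformContinuousOn_iff.1 huc η hη0
  obtain ⟨K, a, ham, ha0, haK, had⟩ := exists_rat_partition hpq hδ
  have ham' : Monotone fun i => (a i : ℝ) := fun i k hik => Rat.cast_le.2 (ham hik)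
  have hsub : ∀ i < K, Icc (a i : ℝ) (a (i + 1)) ⊆ Icc (p : ℝ) q := by
    intro i hi
    apply Icc_subset_Icc
    · rw [← ha0]; exact ham' (Nat.zero_le i)
    · rw [← haK]; exact ham' hi
  have hle : ∀ i, (a i : ℝ) ≤ a (i + 1) := fun i => ham' (Nat.le_succ i)
  have hnode : ∀ i < K, x (a i) ∈ Metric.closedBall (0 : Euc N) j := fun i hi =>
    hxj _ (hsub' (hsub i hi ⟨le_rfl, hle i⟩))
  have hconst : ∀ i < K, (fun _ => x (a i)) ∈ modOn N Θ (a i) (a (i + 1)) j := fun i hi =>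
    ⟨continuousOn_const, fun _ _ => hnode i hi, fun u _ v _ => by
      simpa using hΘ j _ (abs_nonneg _)⟩
  have hlim : Tendsto (fun τ => ∑ i ∈ Finset.range K,
      ‖∫ u in (a i : ℝ)..(a (i + 1)), f.shift τ (u, x (a i))‖) l
      (𝓝 (∑ i ∈ Finset.range K, ‖∫ u in (a i : ℝ)..(a (i + 1)), g (u, x (a i))‖)) :=
    tendsto_finsetSum _ fun i hi => (tendsto_integral_of_tendsto_car h (ham (Nat.le_succ i))
      (hconst i (Finset.mem_range.1 hi))).norm
  have hmain : ∑ i ∈ Finset.range K, ‖∫ u in (a i : ℝ)..(a (i + 1)), g (u, x (a i))‖ ≤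
      theta f j (q - p) := by
    refine le_of_tendsto hlim (Eventually.of_forall fun τ => ?_)
    have := norm_integral_shift_le_theta hS hf τ (j := j) ham' K (x := fun i _ => x (a i))
      fun i hi t _ => hnode i hi
    simpa only [ha0, haK] using this
  have hgi' : ∀ i < K, IntervalIntegrable (fun u => g (u, x u)) volume (a i) (a (i + 1)) := by
    intro i hi
    exact g.intervalIntegrable_comp (hle i) (hx.mono ((hsub i hi).trans hsub'))
      fun u hu => hxj u (hsub' (hsub i hi hu))
  have hsplit : ∫ u in (p : ℝ)..q, g (u, x u) =
      ∑ i ∈ Finset.range K, ∫ u in (a i : ℝ)..(a (i + 1)), g (u, x u) := by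
    rw [intervalIntegral.sum_integral_adjacent_intervals (a := fun i => (a i : ℝ)) hgi', ha0, haK]
  have hpiece : ∀ i ∈ Finset.range K, ‖∫ u in (a i : ℝ)..(a (i + 1)), g (u, x u)‖ ≤
      η * (∫ u in (a i : ℝ)..(a (i + 1)), ‖L u‖) +
        ‖∫ u in (a i : ℝ)..(a (i + 1)), g (u, x (a i))‖ := by
    intro i hi
    rw [Finset.mem_range] at hi
    have h1 : ∫ u in (a i : ℝ)..(a (i + 1)), g (u, x u) =
        (∫ u in (a i : ℝ)..(a (i + 1)), (g (u, x u) - g (u, x (a i)))) +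
          ∫ u in (a i : ℝ)..(a (i + 1)), g (u, x (a i)) := by
      rw [intervalIntegral.integral_sub (hgi' i hi) (g.intervalIntegrable_comp (hle i)
        (hconst i hi).1 (hconst i hi).2.1)]
      abel
    rw [h1]
    refine (norm_add_le _ _).trans (add_le_add ?_ le_rfl)
    rw [← intervalIntegral.integral_const_mul]
    refine intervalIntegral.norm_integral_le_of_norm_le (hle i) ?_
      (hLi.toIntervalIntegrable.const_mul _)
    filter_upwards [hLip] with u hu hui
    have hui' : u ∈ Icc (a i : ℝ) (a (i + 1)) := ⟨hui.1.le, hui.2⟩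
    refine (hu _ (hxj u (hsub' (hsub i hi hui'))) _ (hnode i hi)).trans ?_
    have hd := (hosc u (hsub i hi hui') (a i) (hsub i hi ⟨le_rfl, hle i⟩) (by
      rw [Real.dist_eq, abs_of_nonneg (by linarith [hui.1])]
      linarith [had i, hui.2])).le
    rw [dist_eq_norm] at hd
    rw [mul_comm]
    calc ‖x u - x (a i)‖ * L u ≤ ‖x u - x (a i)‖ * ‖L u‖ :=
          mul_le_mul_of_nonneg_left (le_abs_self _) (norm_nonneg _)
      _ ≤ η * ‖L u‖ := mul_le_mul_of_nonneg_right hd (norm_nonneg _)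
  have hs1 := intervalIntegral.sum_integral_adjacent_intervals (f := fun u => ‖L u‖)
    (μ := volume) (a := fun i => (a i : ℝ)) (n := K) fun i _ => hLi.toIntervalIntegrable
  rw [ha0, haK] at hs1
  rw [hsplit]
  refine (norm_sum_le _ _).trans ((Finset.sum_le_sum hpiece).trans ?_)
  rw [Finset.sum_add_distrib, ← Finset.mul_sum, hs1]
  have : η * ∫ u in (p : ℝ)..q, ‖L u‖ ≤ ε := by
    calc _ ≤ η * ((∫ u in (p : ℝ)..q, ‖L u‖) + 1) := by gcongr; linarith
      _ = ε := by rw [hη]; field_simp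
  linarith

end Topology

/-! ### Solutions, the base flow and the cocycle Φ -/

section Solutions

lemma abs_le_of_mem_uIoc_zero {r s : ℝ} (h : r ∈ uIoc 0 s) : |r| ≤ |s| := by
  rcases le_total 0 s with hs | hs
  · rw [uIoc_of_le hs] at h
    rw [abs_of_pos h.1, abs_of_nonneg hs]; exact h.2
  · rw [uIoc_of_ge hs] at h
    rw [abs_of_nonpos h.2, abs_of_nonpos hs]; linarith [h.1]

variable {N : ℕ}

lemma _root_.MeasureTheory.LocallyIntegrable.comp_add_const {E : Type*} [NormedAddCommGroup E]
    [NormedSpace ℝ E] {l : ℝ → E} (hl : LocallyIntegrable l) (τ : ℝ) :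
    LocallyIntegrable fun t => l (t + τ) := by
  have mp := measurePreserving_add_right (volume : Measure ℝ) τ
  rw [locallyIntegrable_iff]
  intro k hk
  have h := hl.integrableOn_isCompact (hk.image (f := fun t : ℝ => t + τ) (by fun_prop))
  exact ((mp.integrableOn_comp_preimage
    (Homeomorph.addRight τ).measurableEmbedding (f := l)).2 h).mono_set (subset_preimage_image _ _)

lemma IsLC.shift {V : Type*} [NormedAddCommGroup V] [NormedSpace ℝ V]
    [MeasurableSpace V] [BorelSpace V] [SecondCountableTopology V] {g : Car N V} (hg : IsLC g)
    (τ : ℝ) : IsLC (g.shift τ) := by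
  intro K hK
  obtain ⟨l, hl, h⟩ := hg K hK
  exact ⟨_, hl.comp_add_const τ,
    (measurePreserving_add_right (volume : Measure ℝ) τ).quasiMeasurePreserving.ae h⟩

/-- Grönwall with ε = 0, on a ball containing both solutions up to time |t|. It makes the choice in
`sol` harmless. -/
lemma IsSolution.eq_of_isLC {g : Car N (Euc N)} (hg : IsLC g) {x₀ : Euc N} {x y : ℝ → Euc N}
    (hx : IsSolution g x₀ x) (hy : IsSolution g x₀ y) : x = y := by
  funext t
  obtain ⟨j₁, hj₁⟩ := exists_nat_forall_mem_closedBall hx.1 (isCompact_Icc (a := -|t|) (b := |t|))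
  obtain ⟨j₂, hj₂⟩ := exists_nat_forall_mem_closedBall hy.1 (isCompact_Icc (a := -|t|) (b := |t|))
  obtain ⟨L, hL, hLip⟩ := hg _ (isCompact_closedBall (0 : Euc N) (max (j₁ : ℝ) j₂))
  have key := gronwall_abs (l := fun s => ‖L s‖) (u := fun s => ‖x s - y s‖) (ε := 0) (T := |t|)
    hL.toNorm (fun _ => norm_nonneg _) (hx.1.sub hy.1).norm (fun _ => norm_nonneg _) ?_ (le_refl |t|)
  · rw [mul_zero, zero_mul] at key
    exact sub_eq_zero.1 (norm_le_zero_iff.1 key)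
  · intro s hs
    have : x s - y s = ∫ r in (0 : ℝ)..s, (g (r, x r) - g (r, y r)) := by
      rw [intervalIntegral.integral_sub
        (g.locallyIntegrable_comp hx.1).toIntervalIntegrable
        (g.locallyIntegrable_comp hy.1).toIntervalIntegrable, hx.2 s, hy.2 s]
      abel
    rw [this, zero_add]
    refine intervalIntegral.norm_integral_le_abs_of_norm_le ?_
      (hL.toNorm.mul_continuous (hx.1.sub hy.1).norm).toIntervalIntegrable
    filter_upwards [ae_restrict_of_ae hLip, ae_restrict_mem measurableSet_uIoc] with r hr hrs
    have hrt := abs_le.1 ((abs_le_of_mem_uIoc_zero hrs).trans hs)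
    have h1 : x r ∈ Metric.closedBall (0 : Euc N) (max (j₁ : ℝ) j₂) := by
      rw [mem_closedBall_zero_iff]
      exact le_trans (by linarith [hj₁ r hrt]) (le_max_left _ _)
    have h2 : y r ∈ Metric.closedBall (0 : Euc N) (max (j₁ : ℝ) j₂) := by
      rw [mem_closedBall_zero_iff]
      exact le_trans (by linarith [hj₂ r hrt]) (le_max_right _ _)
    exact (hr _ h1 _ h2).trans (mul_le_mul_of_nonneg_right (le_abs_self _) (norm_nonneg _))

lemma sol_isSolution {g : Car N (Euc N)} {x₀ : Euc N} (h : ∃ x, IsSolution g x₀ x) :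
    IsSolution g x₀ (sol g x₀) := by
  rw [sol, dif_pos h]
  exact h.choose_spec

lemma sol_eq {g : Car N (Euc N)} (hg : IsLC g) {x₀ : Euc N} {x : ℝ → Euc N}
    (h : IsSolution g x₀ x) : sol g x₀ = x :=
  (sol_isSolution ⟨x, h⟩).eq_of_isLC hg h

lemma IsSolution.shift {g : Car N (Euc N)} {x₀ : Euc N} {x : ℝ → Euc N}
    (h : IsSolution g x₀ x) (τ : ℝ) : IsSolution (g.shift τ) (x τ) fun s => x (s + τ) := by
  refine ⟨h.1.comp (by fun_prop), fun t => ?_⟩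
  have hi := fun a b => (g.locallyIntegrable_comp h.1).toIntervalIntegrable (a := a) (b := b)
  simp only [Car.shift_apply]
  rw [intervalIntegral.integral_comp_add_right (fun s => g (s, x s)), zero_add, h.2 τ, h.2 (t + τ),
    add_assoc, intervalIntegral.integral_add_adjacent_intervals (hi _ _) (hi _ _)]

/-- The data of a triple `(g, G, x₀)` used along the linearized flow. It is invariant under the
base flow. -/
structure IsRegular (mode : Mode) (Θ ρ : ℕ → ℝ → ℝ) (ω : Triple N) : Prop where
  isLC : IsLC ω.1
  norm_integral_le : ∀ (j : ℕ) (s t : ℝ), s ≤ t → ∀ x : ℝ → Euc N, ContinuousOn x (Icc s t) →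
    (∀ u ∈ Icc s t, x u ∈ Metric.closedBall (0 : Euc N) j) →
    ‖∫ u in s..t, ω.1 (u, x u)‖ ≤ Θ j (t - s)
  integral_norm_le : mode = Mode.weak → ∀ (j : ℕ) (s t : ℝ), s ≤ t → ∀ x ∈ modOn N Θ s t j,
    ∫ u in s..t, ‖ω.2.1 (u, x u)‖ ≤ ρ j (t - s)
  exists_solution : ∃ x, IsSolution ω.1 ω.2.2 x

variable {mode : Mode} {Θ ρ : ℕ → ℝ → ℝ} {ω : Triple N}

/-- The solution starting from a triple. -/
noncomputable def Triple.traj (ω : Triple N) : ℝ → Euc N := sol ω.1 ω.2.2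

/-- The coefficient matrix `G(s, x(s))` along the solution. -/
noncomputable def Triple.coeff (ω : Triple N) (s : ℝ) : Mat N := ω.2.1 (s, ω.traj s)

lemma IsRegular.isSolution (h : IsRegular mode Θ ρ ω) : IsSolution ω.1 ω.2.2 ω.traj :=
  sol_isSolution h.exists_solution

lemma IsRegular.traj_zero (h : IsRegular mode Θ ρ ω) : ω.traj 0 = ω.2.2 := by
  have := h.isSolution.2 0
  simpa using this

/-- A translated solution solves the translated equation, and uniqueness identifies it. -/
lemma IsRegular.traj_baseFlow (h : IsRegular mode Θ ρ ω) (t s : ℝ) :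
    (baseFlow t ω).traj s = ω.traj (s + t) :=
  congrFun (sol_eq (h.isLC.shift t) (h.isSolution.shift t)) s

lemma IsRegular.coeff_baseFlow (h : IsRegular mode Θ ρ ω) (t s : ℝ) :
    (baseFlow t ω).coeff s = ω.coeff (s + t) := by
  rw [Triple.coeff, h.traj_baseFlow]
  rfl

lemma IsRegular.baseFlow_zero (h : IsRegular mode Θ ρ ω) : baseFlow 0 ω = ω := by
  have h0 : sol ω.1 ω.2.2 0 = ω.2.2 := h.traj_zero
  rw [baseFlow, Car.shift_zero, Car.shift_zero, h0]

lemma IsRegular.baseFlow_baseFlow (h : IsRegular mode Θ ρ ω) (s t : ℝ) :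
    baseFlow s (baseFlow t ω) = baseFlow (s + t) ω := by
  have h1 : sol (baseFlow t ω).1 (baseFlow t ω).2.2 s = sol ω.1 ω.2.2 (s + t) := h.traj_baseFlow t s
  rw [baseFlow, h1]
  simp only [baseFlow, Car.shift_shift]

lemma IsRegular.baseFlow (h : IsRegular mode Θ ρ ω) (τ : ℝ) :
    IsRegular mode Θ ρ (baseFlow τ ω) := by
  have hmaps : ∀ s t : ℝ, MapsTo (fun u => u - τ) (Icc (s + τ) (t + τ)) (Icc s t) :=
    fun s t u hu => ⟨by linarith [hu.1], by linarith [hu.2]⟩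
  refine ⟨h.isLC.shift τ, fun j s t hst x hx hxj => ?_, fun hm j s t hst x hx => ?_,
    ⟨_, h.isSolution.shift τ⟩⟩
  · have := h.norm_integral_le j (s + τ) (t + τ) (by linarith) (fun u => x (u - τ))
      (hx.comp (by fun_prop) (hmaps s t)) fun u hu => hxj _ (hmaps s t hu)
    rw [add_sub_add_right_eq_sub, ← intervalIntegral.integral_comp_add_right] at this
    simp only [add_sub_cancel_right] at this
    exact this
  · have := h.integral_norm_le hm j (s + τ) (t + τ) (by linarith) (fun u => x (u - τ))
      ⟨hx.1.comp (by fun_prop) (hmaps s t), fun u hu => hx.2.1 _ (hmaps s t hu),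
        fun u hu v hv => by
          simpa using hx.2.2 _ (hmaps s t hu) _ (hmaps s t hv)⟩
    rw [add_sub_add_right_eq_sub,
      ← intervalIntegral.integral_comp_add_right (fun u => ‖ω.2.1 (u, x (u - τ))‖)] at this
    simp only [add_sub_cancel_right] at this
    exact this

/-- An increment of a solution is the integral of g along the solution itself. There is no
circularity, because the bound in `IsRegular` holds for every continuous curve in the ball and
presupposes no modulus. -/
lemma IsRegular.traj_mem_modOn (h : IsRegular mode Θ ρ ω) {a b : ℝ} {j : ℕ}
    (hj : ∀ t ∈ Icc a b, ω.traj t ∈ Metric.closedBall (0 : Euc N) j) :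
    ω.traj ∈ modOn N Θ a b j := by
  have hi := fun a b => (ω.1.locallyIntegrable_comp h.isSolution.1).toIntervalIntegrable
    (a := a) (b := b)
  have key : ∀ s ∈ Icc a b, ∀ t ∈ Icc a b, s ≤ t → ‖ω.traj t - ω.traj s‖ ≤ Θ j (t - s) := by
    intro s hs t ht hst
    rw [h.isSolution.2 t, h.isSolution.2 s, add_sub_add_left_eq_sub,
      intervalIntegral.integral_interval_sub_left (hi _ _) (hi _ _)]
    exact h.norm_integral_le j s t hst _ h.isSolution.1.continuousOn
      fun u hu => hj u ⟨hs.1.trans hu.1, hu.2.trans ht.2⟩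
  refine ⟨h.isSolution.1.continuousOn, hj, fun s hs t ht => ?_⟩
  rcases le_total s t with hst | hst
  · rw [abs_of_nonneg (by linarith)]; exact key s hs t ht hst
  · rw [abs_of_nonpos (by linarith), norm_sub_rev, neg_sub]; exact key t ht s hs hst

lemma IsRegular.locallyIntegrable_coeff (h : IsRegular mode Θ ρ ω) :
    LocallyIntegrable ω.coeff :=
  ω.2.1.locallyIntegrable_comp h.isSolution.1

/-- Along the flow, the quotient defining A(ω_s) is the difference quotient at s of the primitive of
G(u, x(u)), so Lebesgue's differentiation theorem applies. -/
lemma IsRegular.ae_coeffA (h : IsRegular mode Θ ρ ω) :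
    ∀ᵐ s : ℝ, coeffA (CarathODE.baseFlow s ω) = ω.coeff s := by
  have hl := h.locallyIntegrable_coeff
  filter_upwards [_root_.LocallyIntegrable.ae_hasDerivAt_integral hl] with s hs
  have hlim : Tendsto (fun r : ℝ => r⁻¹ • ∫ u in (0 : ℝ)..r, (CarathODE.baseFlow s ω).2.1
      (u, sol (CarathODE.baseFlow s ω).1 (CarathODE.baseFlow s ω).2.2 u)) (𝓝[≠] 0)
      (𝓝 (ω.coeff s)) := by
    have h1 := hasDerivAt_iff_tendsto_slope_zero.1 (hs s)
    refine h1.congr fun r => ?_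
    rw [intervalIntegral.integral_same, sub_zero]
    have h2 : ∀ u, (CarathODE.baseFlow s ω).2.1
        (u, sol (CarathODE.baseFlow s ω).1 (CarathODE.baseFlow s ω).2.2 u) = ω.coeff (u + s) :=
      fun u => h.coeff_baseFlow s u
    simp only [h2]
    rw [intervalIntegral.integral_comp_add_right, zero_add, add_comm r s]
  have hex : ∃ L : Mat N, Tendsto (fun r : ℝ => r⁻¹ • ∫ u in (0 : ℝ)..r,
      (CarathODE.baseFlow s ω).2.1
      (u, sol (CarathODE.baseFlow s ω).1 (CarathODE.baseFlow s ω).2.2 u)) (𝓝[≠] 0) (𝓝 L) :=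
    ⟨_, hlim⟩
  rw [coeffA, dif_pos hex]
  exact tendsto_nhds_unique hex.choose_spec hlim

lemma IsRegular.isFundamental_iff (h : IsRegular mode Θ ρ ω) {Φ : ℝ → Mat N} :
    IsFundamental ω Φ ↔ IsPrincipal ω.coeff Φ := by
  have : ∀ t, ∫ s in (0 : ℝ)..t, coeffA (CarathODE.baseFlow s ω) * Φ s =
      ∫ s in (0 : ℝ)..t, ω.coeff s * Φ s := by
    intro t
    apply intervalIntegral.integral_congr_ae
    filter_upwards [h.ae_coeffA] with s hs _
    rw [hs]
  simp only [IsFundamental, IsPrincipal, this]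

lemma IsRegular.isPrincipal_fundMat (h : IsRegular mode Θ ρ ω) :
    IsPrincipal ω.coeff fun t => fundMat t ω := by
  have hex : ∃ Φ, IsFundamental ω Φ := by
    obtain ⟨Φ, hΦ⟩ := exists_isPrincipal h.locallyIntegrable_coeff
    exact ⟨Φ, h.isFundamental_iff.2 hΦ⟩
  have : (fun t => fundMat t ω) = hex.choose := by
    funext t
    rw [fundMat, dif_pos hex]
  rw [this, ← h.isFundamental_iff]
  exact hex.choose_spec

lemma IsRegular.fundMat_zero (h : IsRegular mode Θ ρ ω) : fundMat 0 ω = 1 := by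
  simpa using h.isPrincipal_fundMat.2 0

/-- Both sides, as functions of t, solve the linear system along ω_s with the value Φ(s, ω) at time
0. -/
lemma IsRegular.fundMat_add (h : IsRegular mode Θ ρ ω) (t s : ℝ) :
    fundMat (t + s) ω = fundMat t (CarathODE.baseFlow s ω) * fundMat s ω := by
  have hl := h.locallyIntegrable_coeff
  have hls := (h.baseFlow s).locallyIntegrable_coeff
  have h1 := h.isPrincipal_fundMat
  have h2 := (h.baseFlow s).isPrincipal_fundMat
  refine congrFun (linear_unique (A := (CarathODE.baseFlow s ω).coeff) (c := fundMat s ω)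
    (Φ := fun t => fundMat (t + s) ω)
    (Ψ := fun t => fundMat t (CarathODE.baseFlow s ω) * fundMat s ω)
    hls (h1.1.comp (by fun_prop)) (h2.1.mul continuous_const) (fun r => ?_) fun r => ?_) t
  · simp only [h.coeff_baseFlow]
    rw [intervalIntegral.integral_comp_add_right (fun u => ω.coeff u * fundMat u ω), zero_add]
    exact h1.eq_add_integral hl s (r + s)
  · exact h2.mul_const hls _ r

lemma IsRegular.fundMat_neg_mul (h : IsRegular mode Θ ρ ω) (s : ℝ) :
    fundMat (-s) (CarathODE.baseFlow s ω) * fundMat s ω = 1 := by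
  rw [← h.fundMat_add, neg_add_cancel, h.fundMat_zero]

lemma IsRegular.fundMat_mul_neg (h : IsRegular mode Θ ρ ω) (s : ℝ) :
    fundMat s ω * fundMat (-s) (CarathODE.baseFlow s ω) = 1 := by
  have := (h.baseFlow s).fundMat_neg_mul (-s)
  rwa [neg_neg, h.baseFlow_baseFlow, neg_add_cancel, h.baseFlow_zero] at this

lemma IsRegular.isUnit_fundMat (h : IsRegular mode Θ ρ ω) (s : ℝ) : IsUnit (fundMat s ω) :=
  ⟨⟨_, _, h.fundMat_mul_neg s, h.fundMat_neg_mul s⟩, rfl⟩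

end Solutions

/-! ### Continuous dependence of solutions and of Φ on the base point -/

section Continuity

/-- A continuity argument on symmetric intervals. -/
lemma forall_abs_le_of_bootstrap {u : ℝ → ℝ} (hu : Continuous u) {c r : ℝ} (hc : c < 1)
    (h0 : u 0 ≤ c)
    (h : ∀ T, 0 ≤ T → T ≤ r → (∀ t, |t| ≤ T → u t ≤ 1) → ∀ t, |t| ≤ T → u t ≤ c) :
    ∀ t, |t| ≤ r → u t ≤ c := by
  set v : ℝ → ℝ := fun T => max (u T) (u (-T)) with hv
  have hvc : Continuous v := by fun_prop
  have huv : ∀ t, u t ≤ v |t| := by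
    intro t
    rcases abs_choice t with h | h <;> rw [h] <;> simp [hv]
  have hbad : ∀ T ∈ Icc 0 r, v T < 1 := by
    by_contra! hne
    obtain ⟨T₁, hT₁, hvT₁⟩ := hne
    -- Take the first T₀ at which v reaches 1. Before T₀ the hypothesis improves v < 1 to v ≤ c, and
    -- by continuity v T₀ ≤ c < 1.
    have hcomp : IsCompact (Icc 0 r ∩ {T | 1 ≤ v T}) :=
      isCompact_Icc.inter_right (isClosed_le continuous_const hvc)
    obtain ⟨T₀, ⟨hT₀, hvT₀⟩, hmin⟩ := hcomp.exists_isLeast ⟨T₁, hT₁, hvT₁⟩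
    have hlt : ∀ T, 0 ≤ T → T < T₀ → v T < 1 := by
      intro T hT hTT
      by_contra! hle
      exact absurd (hmin ⟨⟨hT, hTT.le.trans hT₀.2⟩, hle⟩) (not_le.2 hTT)
    have hle : ∀ T, 0 ≤ T → T < T₀ → v T ≤ c := by
      intro T hT hTT
      have := h T hT (hTT.le.trans hT₀.2) fun t ht =>
        (huv t).trans (hlt _ (abs_nonneg t) (ht.trans_lt hTT)).le
      exact max_le (this T (abs_of_nonneg hT).le) (this (-T) (by rw [abs_neg, abs_of_nonneg hT]))
    have hpos : 0 < T₀ := by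
      rcases hT₀.1.eq_or_lt with h' | h'
      · rw [← h'] at hvT₀
        have : v 0 ≤ c := by simp [hv, h0]
        have h1 : 1 ≤ v 0 := hvT₀
        linarith
      · exact h'
    have hlim : Tendsto v (𝓝[<] T₀) (𝓝 (v T₀)) := hvc.continuousAt.tendsto.mono_left inf_le_left
    have : v T₀ ≤ c := by
      refine le_of_tendsto hlim ?_
      filter_upwards [self_mem_nhdsWithin, mem_nhdsWithin_of_mem_nhds (lt_mem_nhds hpos)] with T h1 h2
      exact hle T (le_of_lt h2) h1
    have h1 : 1 ≤ v T₀ := hvT₀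
    linarith
  intro t ht
  exact h r ((abs_nonneg t).trans ht) le_rfl
    (fun t ht => (huv t).trans (hbad _ ⟨abs_nonneg t, ht⟩).le) t ht

variable {N : ℕ} {mode : Mode} {Θ ρ : ℕ → ℝ → ℝ}

lemma abs_integral_le_of_abs_le {l : ℝ → ℝ} (hl : LocallyIntegrable l) (h0 : ∀ t, 0 ≤ l t) {t r : ℝ}
    (ht : |t| ≤ r) : |∫ s in (0 : ℝ)..t, l s| ≤ ∫ s in (-r)..r, l s := by
  have htr := abs_le.1 ht
  rw [intervalIntegral.abs_integral_eq_abs_integral_uIoc,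
    abs_of_nonneg (setIntegral_nonneg measurableSet_uIoc fun u _ => h0 u),
    intervalIntegral.integral_of_le (by linarith)]
  refine setIntegral_mono_set (hl.toIntervalIntegrable (a := -r) (b := r)).1
    (ae_of_all _ h0) (LE.le.eventuallyLE fun u hu => ?_)
  rcases le_total 0 t with h | h
  · rw [uIoc_of_le h] at hu; exact ⟨by linarith [hu.1], by linarith [hu.2]⟩
  · rw [uIoc_of_ge h] at hu; exact ⟨by linarith [hu.1], by linarith [hu.2]⟩

/-- The estimate is uniform in the curve and in real t. Finitely many seminorms handle the intervals
between 0 and the multiples of a rational δ; on the remainder, shorter than δ, the moduli bound each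
of the two integrals by ε / 4. -/
lemma eventually_norm_integral_sub_le {ι : Type*} {F : Filter ι} {g : ι → Car N (Euc N)}
    {g' : Car N (Euc N)} (hg : Tendsto g F (@nhds _ (carTopology mode Θ N (Euc N)) g'))
    (hΘ : ∀ j, IsModulus (Θ j)) (j : ℕ) (r : ℝ) {ε : ℝ} (hε : 0 < ε) :
    ∀ᶠ n in F, ∀ x : ℝ → Euc N, ∀ t, |t| ≤ r → x ∈ modOn N Θ (-|t|) |t| j →
      (∀ s t', -|t| ≤ s → s ≤ t' → t' ≤ |t| → ‖∫ u in s..t', g n (u, x u)‖ ≤ Θ j (t' - s)) →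
      (∀ s t', -|t| ≤ s → s ≤ t' → t' ≤ |t| → ‖∫ u in s..t', g' (u, x u)‖ ≤ Θ j (t' - s)) →
      ‖∫ u in (0 : ℝ)..t, (g n - g') (u, x u)‖ ≤ ε := by
  obtain ⟨δ₁, hδ₁, hΘδ⟩ := (hΘ j).small (ε / 4) (by positivity)
  obtain ⟨δ, hδ0, hδ⟩ := exists_rat_btwn hδ₁
  set K := ⌈r / δ⌉₊
  have hnodes : ∀ᶠ n in F, ∀ i ∈ Finset.range (K + 1),
      seminorms mode N (Euc N) Θ ((-(i * δ), 0), j) (g n - g') < ε / 2 ∧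
      seminorms mode N (Euc N) Θ ((0, i * δ), j) (g n - g') < ε / 2 := by
    rw [Filter.eventually_all_finset]
    intro i _
    rw [tendsto_car_iff] at hg
    exact (hg _ _ (by positivity)).and (hg _ _ (by positivity))
  filter_upwards [hnodes] with n hn x t htr hx h1 h2
  set k := ⌊|t| / δ⌋₊
  have hk1 : (k : ℝ) * δ ≤ |t| := by
    rw [← le_div_iff₀ hδ0]; exact Nat.floor_le (div_nonneg (abs_nonneg t) hδ0.le)
  have hk2 : |t| < (k + 1) * δ := by
    rw [← div_lt_iff₀ hδ0]; exact Nat.lt_floor_add_one _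
  have hkK : k ≤ K := by
    have : (k : ℝ) ≤ K := by
      refine le_trans ?_ (Nat.le_ceil _)
      rw [le_div_iff₀ hδ0]; linarith
    exact_mod_cast this
  have hk0 : (0 : ℝ) ≤ k * δ := by positivity
  have hk0' : (0 : ℚ) ≤ k * δ := by exact_mod_cast hk0
  obtain ⟨n1, n2⟩ := hn k (Finset.mem_range.2 (by omega))
  have hsmall : Θ j (|t| - k * δ) ≤ ε / 4 :=
    ((hΘ j).mono _ _ (by linarith) (by linarith)).trans hΘδ
  have hint : ∀ (f : Car N (Euc N)) (a b : ℝ), -|t| ≤ a → a ≤ b → b ≤ |t| →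
      IntervalIntegrable (fun u => f (u, x u)) volume a b := fun f a b ha hab hb => by
    have := modOn_subset ha hb hx
    exact f.intervalIntegrable_comp hab this.1 this.2.1
  have hrem : ∀ a b : ℝ, -|t| ≤ a → a ≤ b → b ≤ |t| → b - a = |t| - k * δ →
      ‖∫ u in a..b, (g n - g') (u, x u)‖ ≤ ε / 2 := by
    intro a b ha hab hb hd
    have e1 := h1 a b ha hab hb
    have e2 := h2 a b ha hab hb
    rw [hd] at e1 e2
    simp only [Car.sub_apply]
    rw [intervalIntegral.integral_sub (hint _ _ _ ha hab hb) (hint _ _ _ ha hab hb)]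
    refine (norm_sub_le _ _).trans ?_
    linarith
  rcases le_total 0 t with ht | ht
  · rw [abs_of_nonneg ht] at *
    have e1 := norm_integral_le_seminorms mode (g n - g') hk0' (x := x) (j := j) (Θ := Θ)
      (modOn_subset (by simpa using ht) (by push_cast; exact hk1) hx)
    push_cast at e1
    have e2 := hrem (k * δ) t (by linarith) hk1 le_rfl rfl
    rw [← intervalIntegral.integral_add_adjacent_intervals (b := (k : ℝ) * δ)
      (hint _ _ _ (by linarith) hk0 hk1) (hint _ _ _ (by linarith) hk1 le_rfl)]
    refine (norm_add_le _ _).trans ?_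
    linarith
  · rw [abs_of_nonpos ht, neg_neg] at *
    have e1 := norm_integral_le_seminorms mode (g n - g') (p := -(k * δ)) (q := 0)
      (by linarith) (x := x) (j := j) (Θ := Θ)
      (modOn_subset (by push_cast; linarith) (by simpa using ht) hx)
    push_cast at e1
    have e2 := hrem t (-(k * δ)) le_rfl (by linarith) (by linarith) (by ring)
    rw [intervalIntegral.integral_symm, norm_neg,
      ← intervalIntegral.integral_add_adjacent_intervals (b := -((k : ℝ) * δ))
      (hint _ _ _ le_rfl (by linarith) (by linarith))
      (hint _ _ _ (by linarith) (by linarith) (by linarith))]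
    refine (norm_add_le _ _).trans ?_
    linarith

/-- Continuous dependence of solutions on the vector field and on the initial condition. -/
lemma eventually_norm_traj_sub_le {ι : Type*} {F : Filter ι} {ω : ι → Triple N} {ω' : Triple N}
    (hΘ : ∀ j, IsModulus (Θ j)) (hω : ∀ᶠ n in F, IsRegular mode Θ ρ (ω n))
    (hω' : IsRegular mode Θ ρ ω')
    (hg : Tendsto (fun n => (ω n).1) F (@nhds _ (carTopology mode Θ N (Euc N)) ω'.1))
    (hx : Tendsto (fun n => (ω n).2.2) F (𝓝 ω'.2.2)) (r : ℝ) {ε : ℝ} (hε : 0 < ε) :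
    ∀ᶠ n in F, ∀ t, |t| ≤ r → ‖(ω n).traj t - ω'.traj t‖ ≤ ε := by
  have hs' := hω'.isSolution
  obtain ⟨j, hj⟩ := exists_nat_forall_mem_closedBall hs'.1 (isCompact_Icc (a := -r) (b := r))
  obtain ⟨L, hL, hLip⟩ := hω'.isLC _ (isCompact_closedBall (0 : Euc N) (j : ℝ))
  set C := Real.exp (2 * ∫ s in (-r)..r, ‖L s‖) with hC
  have hCpos : 0 < C := Real.exp_pos _
  -- The target must stay below 1 for the bootstrap; ε₁ is then chosen so that Grönwall's factor 2C
  -- gives at most c.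
  set c := min ε (1 / 2) with hc
  have hc0 : 0 < c := lt_min hε (by norm_num)
  set ε₁ := min c (c / (2 * C)) with hε₁
  have hε₁0 : 0 < ε₁ := lt_min hc0 (by positivity)
  filter_upwards [hω, eventually_norm_integral_sub_le hg hΘ j r (half_pos hε₁0),
    Metric.tendsto_nhds.1 hx (ε₁ / 2) (half_pos hε₁0)] with n hn hEn hxn
  have hs := hn.isSolution
  rw [dist_eq_norm] at hxn
  set u : ℝ → ℝ := fun t => ‖(ω n).traj t - ω'.traj t‖ with hu
  suffices h : ∀ t, |t| ≤ r → u t ≤ c from fun t ht => (h t ht).trans (min_le_left _ _)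
  -- While the trajectories are within distance 1, both remain in B_j, since j was chosen with one
  -- unit of room.
  refine forall_abs_le_of_bootstrap (hs.1.sub hs'.1).norm
    ((min_le_right _ _).trans_lt (by norm_num)) ?_ fun T hT hTr hone t ht => ?_
  · change ‖(ω n).traj 0 - ω'.traj 0‖ ≤ c
    rw [hn.traj_zero, hω'.traj_zero]
    linarith [min_le_left c (c / (2 * C))]
  have hball' : ∀ s, |s| ≤ T → ω'.traj s ∈ Metric.closedBall (0 : Euc N) j := by
    intro s hs
    rw [mem_closedBall_zero_iff]
    linarith [hj s (abs_le.1 (hs.trans hTr))]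
  have hball : ∀ s, |s| ≤ T → (ω n).traj s ∈ Metric.closedBall (0 : Euc N) j := by
    intro s hs
    rw [mem_closedBall_zero_iff]
    have h1 := hj s (abs_le.1 (hs.trans hTr))
    have h2 : ‖(ω n).traj s - ω'.traj s‖ ≤ 1 := hone s hs
    have h3 := norm_add_le ((ω n).traj s - ω'.traj s) (ω'.traj s)
    rw [sub_add_cancel] at h3
    linarith
  have hgron := gronwall_abs (l := fun s => ‖L s‖) (u := u) (ε := ε₁) (T := T)
    hL.toNorm (fun _ => norm_nonneg _) (hs.1.sub hs'.1).norm (fun _ => norm_nonneg _) ?_ ht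
  · refine hgron.trans ?_
    have hb := abs_integral_le_of_abs_le hL.toNorm (fun _ => norm_nonneg _) (ht.trans hTr)
    calc 2 * ε₁ * Real.exp (2 * |∫ s in (0 : ℝ)..t, ‖L s‖|) ≤ 2 * ε₁ * C := by
          rw [hC]; gcongr
      _ ≤ 2 * (c / (2 * C)) * C := by gcongr; exact min_le_right _ _
      _ = c := by field_simp
  · intro s hsT
    have hIcc : ∀ v ∈ Icc (-|s|) |s|, |v| ≤ T := fun v hv => (abs_le.2 hv).trans hsT
    have hE := hEn (ω n).traj s (hsT.trans hTr)
      (hn.traj_mem_modOn fun v hv => hball v (hIcc v hv))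
      (fun a b ha hab hb => hn.norm_integral_le j a b hab _ hs.1.continuousOn
        fun v hv => hball v (hIcc v ⟨ha.trans hv.1, hv.2.trans hb⟩))
      (fun a b ha hab hb => hω'.norm_integral_le j a b hab _ hs.1.continuousOn
        fun v hv => hball v (hIcc v ⟨ha.trans hv.1, hv.2.trans hb⟩))
    have i1 := ((ω n).1.locallyIntegrable_comp hs.1).toIntervalIntegrable (a := 0) (b := s)
    have i2 := (ω'.1.locallyIntegrable_comp hs.1).toIntervalIntegrable (a := 0) (b := s)
    have i3 := (ω'.1.locallyIntegrable_comp hs'.1).toIntervalIntegrable (a := 0) (b := s)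
    -- The error in the field is evaluated along the approximating trajectory, so that only the
    -- Lipschitz bound of the limit field enters; no uniform Lipschitz constants are available along
    -- the filter.
    have heq : (ω n).traj s - ω'.traj s = ((ω n).2.2 - ω'.2.2) +
        (∫ v in (0 : ℝ)..s, ((ω n).1 - ω'.1) (v, (ω n).traj v)) +
        ∫ v in (0 : ℝ)..s, (ω'.1 (v, (ω n).traj v) - ω'.1 (v, ω'.traj v)) := by
      simp only [Car.sub_apply]
      rw [intervalIntegral.integral_sub i1 i2, intervalIntegral.integral_sub i2 i3, hs.2 s, hs'.2 s]
      abel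
    have hlast : ‖∫ v in (0 : ℝ)..s, (ω'.1 (v, (ω n).traj v) - ω'.1 (v, ω'.traj v))‖ ≤
        |∫ v in (0 : ℝ)..s, ‖L v‖ * u v| := by
      refine intervalIntegral.norm_integral_le_abs_of_norm_le ?_
        (locallyIntegrable_mul_continuous hL.toNorm (hs.1.sub hs'.1).norm).toIntervalIntegrable
      filter_upwards [ae_restrict_of_ae hLip, ae_restrict_mem measurableSet_uIoc] with v hv hvs
      have hvT := (abs_le_of_mem_uIoc_zero hvs).trans hsT
      exact (hv _ (hball v hvT) _ (hball' v hvT)).trans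
        (mul_le_mul_of_nonneg_right (le_abs_self _) (norm_nonneg _))
    have h1 := norm_add_le (((ω n).2.2 - ω'.2.2) +
        (∫ v in (0 : ℝ)..s, ((ω n).1 - ω'.1) (v, (ω n).traj v)))
        (∫ v in (0 : ℝ)..s, (ω'.1 (v, (ω n).traj v) - ω'.1 (v, ω'.traj v)))
    have h2 := norm_add_le ((ω n).2.2 - ω'.2.2)
        (∫ v in (0 : ℝ)..s, ((ω n).1 - ω'.1) (v, (ω n).traj v))
    rw [← heq] at h1
    have h3 : u s = ‖(ω n).traj s - ω'.traj s‖ := rfl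
    linarith

/-- Sequential continuity at a point for uniform convergence implies filter continuity. -/
lemma tendsto_of_forall_seq {ι E : Type*} [PseudoMetricSpace E] {F : Filter ι}
    {S : Set (ℝ → Euc N)} {I : Set ℝ} {y : ℝ → Euc N} {J : (ℝ → Euc N) → E} {c : E}
    (h : ∀ x : ℕ → ℝ → Euc N, (∀ n, x n ∈ S) → TendstoUniformlyOn x y atTop I →
      Tendsto (fun n => J (x n)) atTop (𝓝 c))
    {x : ι → ℝ → Euc N} (hx : ∀ᶠ n in F, x n ∈ S)
    (hxy : ∀ ε > 0, ∀ᶠ n in F, ∀ t ∈ I, ‖x n t - y t‖ ≤ ε) :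
    Tendsto (fun n => J (x n)) F (𝓝 c) := by
  rw [Metric.tendsto_nhds]
  intro ε hε
  by_contra hne
  have hfr : ∃ᶠ n in F, ¬ dist (J (x n)) c < ε := not_eventually.1 hne
  -- If convergence fails along the filter, bad indices occur inside every eventual event, which
  -- yields a uniformly convergent sequence of counterexamples.
  have hk : ∀ k : ℕ, ∃ n, ¬ dist (J (x n)) c < ε ∧ x n ∈ S ∧
      ∀ t ∈ I, ‖x n t - y t‖ ≤ 1 / ((k : ℝ) + 1) := fun k =>
    (hfr.and_eventually (hx.and (hxy _ (by positivity)))).exists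
  choose m hm1 hm2 hm3 using hk
  have hu : TendstoUniformlyOn (fun k => x (m k)) y atTop I := by
    rw [Metric.tendstoUniformlyOn_iff]
    intro η hη
    filter_upwards [(tendsto_one_div_add_atTop_nhds_zero_nat (𝕜 := ℝ)).eventually_lt_const hη]
      with k hk t ht
    rw [dist_comm, dist_eq_norm]
    exact (hm3 k t ht).trans_lt hk
  obtain ⟨k, hk⟩ := (Metric.tendsto_nhds.1 (h _ hm2 hu) ε hε).exists
  exact hm1 k hk

lemma setIntegral_Icc_rat_eq {V : Type*} [NormedAddCommGroup V] [NormedSpace ℝ V] {p q : ℚ}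
    (hpq : p ≤ q) (A : ℝ → V) : ∫ t in Icc (p : ℝ) q, A t = ∫ t in (p : ℝ)..q, A t := by
  rw [intervalIntegral.integral_of_le (by exact_mod_cast hpq), ← integral_Icc_eq_integral_Ioc]

/-- The standing assumptions for passing to the limit along a filter of triples. -/
structure ConvergesTo (mode : Mode) (Θ ρ : ℕ → ℝ → ℝ) {ι : Type*} (F : Filter ι)
    (ω : ι → Triple N) (ω' : Triple N) : Prop where
  modulus : ∀ j, IsModulus (Θ j)
  modulus' : mode = Mode.weak → ∀ j, IsModulus (ρ j)
  regular : ∀ᶠ n in F, IsRegular mode Θ ρ (ω n)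
  regular' : IsRegular mode Θ ρ ω'
  isThetaC : IsThetaC mode Θ ω'.2.1
  tendsto : Tendsto ω F (@nhds _ (tripleTopology mode Θ N) ω')

variable {ι : Type*} {F : Filter ι} {ω : ι → Triple N} {ω' : Triple N}

lemma ConvergesTo.tendsto_fst (h : ConvergesTo mode Θ ρ F ω ω') :
    Tendsto (fun n => (ω n).1) F (@nhds _ (carTopology mode Θ N (Euc N)) ω'.1) := by
  let _ := carTopology mode Θ N (Euc N)
  let _ := carTopology mode Θ N (Mat N)
  exact (continuous_fst.tendsto ω').comp h.tendsto

lemma ConvergesTo.tendsto_snd (h : ConvergesTo mode Θ ρ F ω ω') :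
    Tendsto (fun n => (ω n).2.1) F (@nhds _ (carTopology mode Θ N (Mat N)) ω'.2.1) := by
  let _ := carTopology mode Θ N (Euc N)
  let _ := carTopology mode Θ N (Mat N)
  exact ((continuous_fst.comp continuous_snd).tendsto ω').comp h.tendsto

lemma ConvergesTo.tendsto_thd (h : ConvergesTo mode Θ ρ F ω ω') :
    Tendsto (fun n => (ω n).2.2) F (𝓝 ω'.2.2) := by
  let _ := carTopology mode Θ N (Euc N)
  let _ := carTopology mode Θ N (Mat N)
  exact ((continuous_snd.comp continuous_snd).tendsto ω').comp h.tendsto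

lemma ConvergesTo.eventually_traj (h : ConvergesTo mode Θ ρ F ω ω') (r : ℝ) {ε : ℝ} (hε : 0 < ε) :
    ∀ᶠ n in F, ∀ t, |t| ≤ r → ‖(ω n).traj t - ω'.traj t‖ ≤ ε :=
  eventually_norm_traj_sub_le h.modulus h.regular h.regular' h.tendsto_fst h.tendsto_thd r hε

lemma ConvergesTo.exists_modOn (h : ConvergesTo mode Θ ρ F ω ω') (r : ℝ) :
    ∃ j : ℕ, ω'.traj ∈ modOn N Θ (-r) r j ∧ ∀ᶠ n in F, (ω n).traj ∈ modOn N Θ (-r) r j := by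
  obtain ⟨j, hj⟩ := exists_nat_forall_mem_closedBall h.regular'.isSolution.1
    (isCompact_Icc (a := -r) (b := r))
  refine ⟨j, h.regular'.traj_mem_modOn fun t ht => ?_, ?_⟩
  · rw [mem_closedBall_zero_iff]; linarith [hj t ht]
  · filter_upwards [h.regular, h.eventually_traj r one_pos] with n hn hd
    refine hn.traj_mem_modOn fun t ht => ?_
    rw [mem_closedBall_zero_iff]
    have h3 := norm_add_le ((ω n).traj t - ω'.traj t) (ω'.traj t)
    rw [sub_add_cancel] at h3
    linarith [hj t ht, hd t (abs_le.2 ht)]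

lemma exists_nat_Icc_subset (p q : ℚ) : ∃ M : ℕ, Icc (p : ℝ) q ⊆ Icc (-(M : ℝ)) M := by
  obtain ⟨M, hM⟩ := exists_nat_ge (max |(p : ℝ)| |(q : ℝ)|)
  refine ⟨M, Icc_subset_Icc ?_ ?_⟩
  · linarith [neg_abs_le (p : ℝ), le_max_left |(p : ℝ)| |(q : ℝ)|]
  · linarith [le_abs_self (q : ℝ), le_max_right |(p : ℝ)| |(q : ℝ)|]

/-- Compare G_n(x_n) with G'(x') through G'(x_n): the first difference is bounded by a seminorm,
uniformly over the modulus class, and the second tends to 0 by the Θ-continuity of G'. -/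
lemma ConvergesTo.tendsto_integral_norm_coeff_sub (h : ConvergesTo .strong Θ ρ F ω ω') {p q : ℚ}
    (hpq : p ≤ q) :
    Tendsto (fun n => ∫ s in (p : ℝ)..q, ‖(ω n).coeff s - ω'.coeff s‖) F (𝓝 0) := by
  have hpq' : (p : ℝ) ≤ q := by exact_mod_cast hpq
  obtain ⟨M, hM⟩ := exists_nat_Icc_subset p q
  obtain ⟨h1, h2⟩ := (Icc_subset_Icc_iff hpq').1 hM
  obtain ⟨j, hj', hj⟩ := h.exists_modOn M
  have hsub := modOn_subset (N := N) (Θ := Θ) (j := j) h1 h2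
  have hJ : Tendsto (fun n => ∫ t in Icc (p : ℝ) q,
      ‖ω'.2.1 (t, (ω n).traj t) - ω'.2.1 (t, ω'.traj t)‖) F (𝓝 0) := by
    refine tendsto_of_forall_seq (S := modSet N Θ (p, q) j) (y := ω'.traj)
      (J := fun x => ∫ t in Icc (p : ℝ) q, ‖ω'.2.1 (t, x t) - ω'.2.1 (t, ω'.traj t)‖)
      (fun x hx hxy => h.isThetaC (p, q) j x _ hx (hsub hj') hxy)
      (hj.mono fun n hn => hsub hn) fun ε hε => ?_
    filter_upwards [h.eventually_traj M hε] with n hn t ht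
    exact hn t (abs_le.2 (hM ht))
  rw [Metric.tendsto_nhds]
  intro ε hε
  filter_upwards [Metric.tendsto_nhds.1 hJ (ε / 2) (half_pos hε), h.regular, hj,
    tendsto_car_iff.1 h.tendsto_snd ((p, q), j) (ε / 2) (half_pos hε)] with n h3 hn hjn h4
  have h5 := setIntegral_norm_le_seminorms ((ω n).2.1 - ω'.2.1) (q := (p, q)) (hsub hjn)
  rw [setIntegral_Icc_rat_eq hpq] at h5 h3
  have i1 := hn.locallyIntegrable_coeff
  have i2 := h.regular'.locallyIntegrable_coeff
  have i3 := ω'.2.1.locallyIntegrable_comp hn.isSolution.1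
  have hle : ∫ s in (p : ℝ)..q, ‖(ω n).coeff s - ω'.coeff s‖ ≤
      (∫ s in (p : ℝ)..q, ‖((ω n).2.1 - ω'.2.1) (s, (ω n).traj s)‖) +
      ∫ s in (p : ℝ)..q, ‖ω'.2.1 (s, (ω n).traj s) - ω'.2.1 (s, ω'.traj s)‖ :=
    integral_norm_le_add (i1.sub i2) (i1.sub i3) (i3.sub i2) hpq'
      fun s => norm_sub_le_norm_sub_add_norm_sub _ _ _
  rw [Real.dist_eq, sub_zero] at h3 ⊢
  have h6 := le_abs_self (∫ s in (p : ℝ)..q, ‖ω'.2.1 (s, (ω n).traj s) - ω'.2.1 (s, ω'.traj s)‖)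
  rw [abs_of_nonneg (intervalIntegral.integral_nonneg hpq' fun _ _ => norm_nonneg _)]
  linarith

lemma ConvergesTo.tendsto_integral_coeff (h : ConvergesTo mode Θ ρ F ω ω') {p q : ℚ}
    (hpq : p ≤ q) :
    Tendsto (fun n => ∫ s in (p : ℝ)..q, (ω n).coeff s) F (𝓝 (∫ s in (p : ℝ)..q, ω'.coeff s)) := by
  have hpq' : (p : ℝ) ≤ q := by exact_mod_cast hpq
  cases mode with
  | strong =>
    rw [tendsto_iff_norm_sub_tendsto_zero]
    refine squeeze_zero' (Eventually.of_forall fun _ => norm_nonneg _) ?_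
      (h.tendsto_integral_norm_coeff_sub hpq)
    filter_upwards [h.regular] with n hn
    rw [← intervalIntegral.integral_sub hn.locallyIntegrable_coeff.toIntervalIntegrable
      h.regular'.locallyIntegrable_coeff.toIntervalIntegrable]
    exact intervalIntegral.norm_integral_le_integral_norm hpq'
  | weak =>
    obtain ⟨M, hM⟩ := exists_nat_Icc_subset p q
    obtain ⟨h1, h2⟩ := (Icc_subset_Icc_iff hpq').1 hM
    obtain ⟨j, hj', hj⟩ := h.exists_modOn M
    have hsub := modOn_subset (N := N) (Θ := Θ) (j := j) h1 h2
    -- The comparison is again through G'(x_n), now with the norm outside the integral, as weak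
    -- Θ-continuity and the weak seminorms only see that.
    have hJ : Tendsto (fun n => ∫ t in Icc (p : ℝ) q, ω'.2.1 (t, (ω n).traj t)) F
        (𝓝 (∫ t in Icc (p : ℝ) q, ω'.2.1 (t, ω'.traj t))) := by
      refine tendsto_of_forall_seq (S := modSet N Θ (p, q) j) (y := ω'.traj)
        (J := fun x => ∫ t in Icc (p : ℝ) q, ω'.2.1 (t, x t))
        (fun x hx hxy => h.isThetaC (p, q) j x _ hx (hsub hj') hxy)
        (hj.mono fun n hn => hsub hn) fun ε hε => ?_
      filter_upwards [h.eventually_traj M hε] with n hn t ht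
      exact hn t (abs_le.2 (hM ht))
    have hd : Tendsto (fun n => ∫ s in (p : ℝ)..q, ((ω n).2.1 - ω'.2.1) (s, (ω n).traj s)) F
        (𝓝 0) := by
      rw [Metric.tendsto_nhds]
      intro ε hε
      filter_upwards [hj, tendsto_car_iff.1 h.tendsto_snd ((p, q), j) ε hε] with n hjn h4
      rw [dist_zero_right]
      exact (norm_integral_le_seminorms .weak _ hpq (hsub hjn)).trans_lt h4
    have hsum := hd.add hJ
    rw [zero_add, setIntegral_Icc_rat_eq hpq] at hsum
    refine hsum.congr' ?_
    filter_upwards [h.regular] with n hn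
    have i3 := ω'.2.1.locallyIntegrable_comp hn.isSolution.1
    rw [setIntegral_Icc_rat_eq hpq]
    refine (intervalIntegral.integral_add
      (f := fun s => (ω n).coeff s - ω'.2.1 (s, (ω n).traj s))
      (hn.locallyIntegrable_coeff.sub i3).toIntervalIntegrable
      i3.toIntervalIntegrable).symm.trans ?_
    refine intervalIntegral.integral_congr fun s _ => ?_
    exact sub_add_cancel ((ω n).2.1 (s, (ω n).traj s)) (ω'.2.1 (s, (ω n).traj s))

/-- In the strong setting an L¹-convergent family is equi-integrable. In the weak setting there is
no L¹ convergence, and the modulus ρ along the trajectories takes its place. -/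
lemma ConvergesTo.eventuallyEquiintegrable (h : ConvergesTo mode Θ ρ F ω ω') :
    EventuallyEquiintegrable F fun n => (ω n).coeff := by
  intro r ε hε
  cases mode with
  | strong =>
    have i2 := h.regular'.locallyIntegrable_coeff
    obtain ⟨δ, hδ, h1⟩ := exists_forall_short_integral_norm_le i2 r (half_pos hε)
    obtain ⟨M, hM⟩ := exists_nat_ge r
    refine ⟨δ, hδ, ?_⟩
    have hlim := h.tendsto_integral_norm_coeff_sub (p := -M) (q := M)
      (by have : (0 : ℚ) ≤ M := Nat.cast_nonneg M
          linarith)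
    filter_upwards [hlim.eventually_lt_const (half_pos hε), h.regular] with n h2 hn s t hs hst ht hd
    push_cast at h2
    have i1 := hn.locallyIntegrable_coeff
    have h3 : ∫ u in s..t, ‖(ω n).coeff u - ω'.coeff u‖ ≤
        ∫ u in (-(M : ℝ))..M, ‖(ω n).coeff u - ω'.coeff u‖ :=
      intervalIntegral.integral_mono_interval (by linarith) hst (by linarith)
        (ae_of_all _ fun _ => norm_nonneg _) (i1.sub i2).toNorm.toIntervalIntegrable
    have h4 := h1 s t hs hst ht hd
    have h5 : ∫ u in s..t, ‖(ω n).coeff u‖ ≤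
        (∫ u in s..t, ‖(ω n).coeff u - ω'.coeff u‖) + ∫ u in s..t, ‖ω'.coeff u‖ := by
      refine integral_norm_le_add i1 (i1.sub i2) i2 hst fun u => ?_
      have := norm_add_le ((ω n).coeff u - ω'.coeff u) (ω'.coeff u)
      rwa [sub_add_cancel] at this
    linarith
  | weak =>
    obtain ⟨j, -, hj⟩ := h.exists_modOn r
    obtain ⟨δ, hδ, hρ⟩ := (h.modulus' rfl j).small ε hε
    refine ⟨δ, hδ, ?_⟩
    filter_upwards [hj, h.regular] with n hjn hn s t hs hst ht hd
    exact (hn.integral_norm_le rfl j s t hst _ (modOn_subset hs ht hjn)).trans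
      (((h.modulus' rfl j).mono _ _ (by linarith) hd).trans hρ)

/-- Continuity of the fundamental matrix. -/
lemma ConvergesTo.tendsto_fundMat (h : ConvergesTo mode Θ ρ F ω ω') (t : ℝ) :
    Tendsto (fun n => fundMat t (ω n)) F (𝓝 (fundMat t ω')) :=
  tendsto_isPrincipal (Φ := fun n t => fundMat t (ω n)) (Ψ := fun t => fundMat t ω')
    (h.regular.mono fun _ hn => hn.locallyIntegrable_coeff) h.regular'.locallyIntegrable_coeff
    (h.regular.mono fun _ hn => hn.isPrincipal_fundMat) h.regular'.isPrincipal_fundMat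
    (fun _ _ hpq => h.tendsto_integral_coeff hpq) h.eventuallyEquiintegrable t

lemma ConvergesTo.tendsto_inverse_fundMat (h : ConvergesTo mode Θ ρ F ω ω') (t : ℝ) :
    Tendsto (fun n => Ring.inverse (fundMat t (ω n))) F (𝓝 (Ring.inverse (fundMat t ω'))) := by
  obtain ⟨u, hu⟩ := h.regular'.isUnit_fundMat t
  have := NormedRing.inverse_continuousAt u
  rw [hu] at this
  exact this.tendsto.comp (h.tendsto_fundMat t)

end Continuity

/-! ### Transport, limits and uniqueness of dichotomies -/

section Dichotomy

variable {N : ℕ} {mode : Mode} {Θ ρ : ℕ → ℝ → ℝ}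

/-- Pulling the neighbourhood filter back to the translation parameter gives one filter on ℝ along
which both components converge, in place of a sequence. -/
lemma exists_filter_of_mem_hull {f : Car N (Euc N)} {F : Car N (Mat N)}
    {p : Car N (Euc N) × Car N (Mat N)} (hp : p ∈ hull mode f F) :
    ∃ l : Filter ℝ, l.NeBot ∧
      Tendsto (fun τ => f.shift τ) l (@nhds _ (carTopology mode (theta f) N (Euc N)) p.1) ∧
      Tendsto (fun τ => F.shift τ) l (@nhds _ (carTopology mode (theta f) N (Mat N)) p.2) := by
  let _ := carTopology mode (theta f) N (Euc N)
  let _ := carTopology mode (theta f) N (Mat N)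
  have hcl : p ∈ closure (range fun τ : ℝ => (f.shift τ, F.shift τ)) := hp.2.2
  refine ⟨comap (fun τ : ℝ => (f.shift τ, F.shift τ)) (𝓝 p), ?_,
    (continuous_fst.tendsto p).comp tendsto_comap, (continuous_snd.tendsto p).comp tendsto_comap⟩
  rw [comap_neBot_iff]
  intro t ht
  obtain ⟨_, h1, τ, rfl⟩ := mem_closure_iff_nhds.1 hcl t ht
  exact ⟨τ, h1⟩

lemma isRegular_of_mem_Omega {f : Car N (Euc N)} {F : Car N (Mat N)} (hf : IsLC f)
    (hf_bounds : HasEquicontinuousMBounds f) (hF : IsSC F)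
    (hF_bounds : mode = Mode.weak → HasEquicontinuousMBounds F)
    (hglobal : ∀ p ∈ hull mode f F, ∀ x₀ : Euc N, ∃ x, IsSolution p.1 x₀ x)
    {ω : Triple N} (hω : ω ∈ Omega mode f F) : IsRegular mode (theta f) (theta F) ω := by
  obtain ⟨l, hl, h1, h2⟩ := exists_filter_of_mem_hull hω
  refine ⟨hω.1, fun j s t hst x hx hxj => ?_, fun hm j s t hst x hx => ?_, hglobal _ hω _⟩
  · exact norm_integral_le_theta_of_tendsto (fun j => (isModulus_theta hf.isSC hf_bounds j).nonneg)
      hf.isSC hf_bounds h1 hω.1 hst hx hxj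
  · exact integral_norm_le_theta_of_tendsto hF (hF_bounds hm) h2 hst hx

/-- The dichotomy estimates on `J` at a single triple, for a given projection. -/
def DichotomyBound (J : Set ℝ) (ω : Triple N) (P : Mat N) (K α : ℝ) : Prop :=
  ∀ s ∈ J, ∀ t ∈ J,
    (s ≤ t → ‖fundMat t ω * P * Ring.inverse (fundMat s ω)‖ ≤ K * Real.exp (-α * (t - s))) ∧
    (t ≤ s → ‖fundMat t ω * (1 - P) * Ring.inverse (fundMat s ω)‖ ≤ K * Real.exp (α * (t - s)))

variable {ω ω' : Triple N} {P Q : Mat N} {K α : ℝ} {J : Set ℝ}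

lemma IsRegular.inverse_fundMat (h : IsRegular mode Θ ρ ω) (s : ℝ) :
    Ring.inverse (fundMat s ω) = fundMat (-s) (CarathODE.baseFlow s ω) :=
  Ring.inverse_unit ⟨_, _, h.fundMat_mul_neg s, h.fundMat_neg_mul s⟩

lemma eq_zero_of_norm_le_exp {E : Type*} [NormedAddCommGroup E] {X : E} {C β : ℝ} (hβ : 0 < β)
    (h : ∀ t, 0 ≤ t → ‖X‖ ≤ C * Real.exp (-(β * t))) : X = 0 := by
  have hlim : Tendsto (fun t : ℝ => C * Real.exp (-(β * t))) atTop (𝓝 (C * 0)) :=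
    (Real.tendsto_exp_neg_atTop_nhds_zero.comp (tendsto_id.const_mul_atTop hβ)).const_mul C
  rw [mul_zero] at hlim
  exact norm_le_zero_iff.1 (ge_of_tendsto hlim
    ((eventually_ge_atTop 0).mono fun t ht => h t ht))

/-- The projection of a dichotomy on the whole line is unique. -/
lemma DichotomyBound.unique (hω : IsRegular mode Θ ρ ω) (hα : 0 < α)
    (hP : DichotomyBound univ ω P K α) (hQ : DichotomyBound univ ω Q K α) : P = Q := by
  have hu : ∀ t, Ring.inverse (fundMat t ω) * fundMat t ω = 1 := fun t =>
    Ring.inverse_mul_cancel _ (hω.isUnit_fundMat t)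
  have h0 := hω.fundMat_zero
  have key : ∀ (X Y : Mat N) (t a b : ℝ),
      ‖fundMat 0 ω * X * Ring.inverse (fundMat t ω)‖ ≤ a →
      ‖fundMat t ω * Y * Ring.inverse (fundMat 0 ω)‖ ≤ b → ‖X * Y‖ ≤ a * b := by
    intro X Y t a b ha hb
    rw [h0, Ring.inverse_one, mul_one] at hb
    rw [h0, one_mul] at ha
    have : X * Y = (X * Ring.inverse (fundMat t ω)) * (fundMat t ω * Y) := by
      rw [mul_assoc, ← mul_assoc _ (fundMat t ω), hu, one_mul]
    rw [this]
    exact (norm_mul_le _ _).trans (mul_le_mul ha hb (norm_nonneg _) ((norm_nonneg _).trans ha))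
  -- Insert Φ(t)⁻¹Φ(t) between the factors. As t → +∞ both decay like exp(−αt); the next identity
  -- uses t → −∞ in the same way. Together they give Q = PQ = P.
  have e1 : (1 - P) * Q = 0 := by
    refine eq_zero_of_norm_le_exp (C := K * K) (show 0 < 2 * α by positivity) fun t ht => ?_
    refine (key _ _ t _ _ ((hP t trivial 0 trivial).2 ht)
      ((hQ 0 trivial t trivial).1 ht)).trans_eq ?_
    rw [mul_mul_mul_comm, ← Real.exp_add]
    ring_nf
  have e2 : P * (1 - Q) = 0 := by
    refine eq_zero_of_norm_le_exp (C := K * K) (show 0 < 2 * α by positivity) fun t ht => ?_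
    have ht' : -t ≤ 0 := by linarith
    refine (key _ _ (-t) _ _ ((hP (-t) trivial 0 trivial).1 ht')
      ((hQ 0 trivial (-t) trivial).2 ht')).trans_eq ?_
    rw [mul_mul_mul_comm, ← Real.exp_add]
    ring_nf
  rw [sub_mul, one_mul, sub_eq_zero] at e1
  rw [mul_sub, mul_one, sub_eq_zero] at e2
  exact e2.trans e1.symm

/-- The dichotomy estimates pass to the limit. -/
lemma ConvergesTo.dichotomyBound {ι : Type*} {F : Filter ι} [F.NeBot] {ω : ι → Triple N}
    {P : ι → Mat N} {P' : Mat N} (h : ConvergesTo mode Θ ρ F ω ω') (hP : Tendsto P F (𝓝 P'))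
    (hb : ∀ s t, ∀ᶠ n in F, DichotomyBound {s, t} (ω n) (P n) K α) :
    DichotomyBound univ ω' P' K α := by
  intro s _ t _
  refine ⟨fun hst => ?_, fun hst => ?_⟩
  · refine le_of_tendsto (((h.tendsto_fundMat t).mul hP).mul (h.tendsto_inverse_fundMat s)).norm ?_
    filter_upwards [hb s t] with n hn
    exact (hn s (by simp) t (by simp)).1 hst
  · refine le_of_tendsto (((h.tendsto_fundMat t).mul (hP.const_sub 1)).mul
      (h.tendsto_inverse_fundMat s)).norm ?_
    filter_upwards [hb s t] with n hn
    exact (hn s (by simp) t (by simp)).2 hst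

lemma DichotomyBound.norm_le (hω : IsRegular mode Θ ρ ω) (h0 : (0 : ℝ) ∈ J)
    (h : DichotomyBound J ω P K α) : ‖P‖ ≤ K := by
  have := (h 0 h0 0 h0).1 le_rfl
  simpa [hω.fundMat_zero] using this

/-- Transport of a projection along the flow. -/
noncomputable def transport (τ : ℝ) (ω : Triple N) (P : Mat N) : Mat N :=
  fundMat τ ω * P * Ring.inverse (fundMat τ ω)

/-- By the cocycle identity, the estimate for ω_τ at times (s, t) is the estimate for ω at (s + τ, t
+ τ), so transport leaves K and α unchanged. -/
lemma IsRegular.fundMat_mul_transport (h : IsRegular mode Θ ρ ω) (τ s t : ℝ) (P : Mat N) :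
    fundMat t (CarathODE.baseFlow τ ω) * transport τ ω P *
        Ring.inverse (fundMat s (CarathODE.baseFlow τ ω)) =
      fundMat (t + τ) ω * P * Ring.inverse (fundMat (s + τ) ω) := by
  -- This is Φ(s + τ, ω)⁻¹ = Φ(τ, ω)⁻¹ Φ(s, ω_τ)⁻¹, with inverses written as backward evolution.
  have h1 := (h.baseFlow (s + τ)).fundMat_add (-τ) (-s)
  rw [h.baseFlow_baseFlow, neg_add_cancel_left] at h1
  rw [transport, h.inverse_fundMat, h.inverse_fundMat, (h.baseFlow τ).inverse_fundMat,
    h.baseFlow_baseFlow, h.fundMat_add t τ, neg_add_rev, h1]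
  simp only [mul_assoc]

lemma IsRegular.isIdempotentElem_transport (h : IsRegular mode Θ ρ ω) (τ : ℝ)
    (hP : IsIdempotentElem P) : IsIdempotentElem (transport τ ω P) := by
  have hu := Ring.inverse_mul_cancel _ (h.isUnit_fundMat τ)
  rw [IsIdempotentElem, transport]
  calc _ = fundMat τ ω * P * (Ring.inverse (fundMat τ ω) * fundMat τ ω) * P *
        Ring.inverse (fundMat τ ω) := by simp only [mul_assoc]
    _ = fundMat τ ω * (P * P) * Ring.inverse (fundMat τ ω) := by
        rw [hu, mul_one, mul_assoc (fundMat τ ω) P P]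
    _ = _ := by rw [hP.eq]

lemma IsRegular.transport_one_sub (h : IsRegular mode Θ ρ ω) (τ : ℝ) (P : Mat N) :
    transport τ ω (1 - P) = 1 - transport τ ω P := by
  rw [transport, mul_sub, sub_mul, mul_one, Ring.mul_inverse_cancel _ (h.isUnit_fundMat τ),
    transport]

lemma DichotomyBound.transport (hω : IsRegular mode Θ ρ ω) (h : DichotomyBound J ω P K α) {τ : ℝ}
    {I : Set ℝ} (hI : ∀ t ∈ I, t + τ ∈ J) :
    DichotomyBound I (baseFlow τ ω) (transport τ ω P) K α := by
  intro s hs t ht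
  rw [← hω.transport_one_sub, hω.fundMat_mul_transport, hω.fundMat_mul_transport]
  have := h _ (hI s hs) _ (hI t ht)
  simpa using this

lemma exists_tendsto_of_norm_le {ι : Type*} (U : Ultrafilter ι) {P : ι → Mat N} {K : ℝ}
    (h : ∀ᶠ n in U, ‖P n‖ ≤ K) : ∃ P', Tendsto P U (𝓝 P') := by
  obtain ⟨P', -, hP'⟩ := (isCompact_closedBall (0 : Mat N) K).ultrafilter_le_nhds (U.map P)
    (by
      rw [le_principal_iff]
      change ∀ᶠ n in U, P n ∈ Metric.closedBall (0 : Mat N) K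
      filter_upwards [h] with n hn
      simpa using hn)
  exact ⟨P', hP'⟩

/-- A dichotomy along an orbit gives a dichotomy on the whole line at limit points. -/
lemma exists_dichotomyBound_of_tendsto {l : Filter ℝ} [l.NeBot]
    (hω : IsRegular mode Θ ρ ω) (h : ConvergesTo mode Θ ρ l (fun τ => baseFlow τ ω) ω')
    (hP : IsIdempotentElem P) (hb : DichotomyBound J ω P K α)
    (hl : ∀ t, ∀ᶠ τ in l, t + τ ∈ J) :
    ∃ P', IsIdempotentElem P' ∧ DichotomyBound univ ω' P' K α := by
  have hbt : ∀ s t, ∀ᶠ τ in l, DichotomyBound {s, t} (baseFlow τ ω) (transport τ ω P) K α := by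
    intro s t
    filter_upwards [hl s, hl t] with τ h1 h2
    refine hb.transport hω ?_
    rintro r (rfl | rfl)
    exacts [h1, h2]
  -- Refining to an ultrafilter makes the bounded projections converge outright while keeping all
  -- eventual properties of l.
  set U := Ultrafilter.of l
  have hU : (U : Filter ℝ) ≤ l := Ultrafilter.of_le l
  obtain ⟨P', hP'⟩ := exists_tendsto_of_norm_le U (P := fun τ => transport τ ω P) (K := K) (by
    filter_upwards [hU (hbt 0 0)] with τ hτ
    exact hτ.norm_le (hω.baseFlow τ) (by simp))
  have hU' : ConvergesTo mode Θ ρ (U : Filter ℝ) (fun τ => baseFlow τ ω) ω' :=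
    ⟨h.modulus, h.modulus', hU h.regular, h.regular', h.isThetaC, h.tendsto.mono_left hU⟩
  refine ⟨P', ?_, hU'.dichotomyBound hP' fun s t => hU (hbt s t)⟩
  exact tendsto_nhds_unique ((hP'.mul hP').congr fun τ => hω.isIdempotentElem_transport τ hP) hP'

/-- Pointwise dichotomies on the line with uniform constants form a dichotomy over the set. -/
lemma hasExpDichotomy_univ_of_forall {Δ : Set (Triple N)} (hΘ : ∀ j, IsModulus (Θ j))
    (hρ : mode = Mode.weak → ∀ j, IsModulus (ρ j)) (hΔ : ∀ ω ∈ Δ, IsRegular mode Θ ρ ω)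
    (hΔ' : ∀ ω ∈ Δ, IsThetaC mode Θ ω.2.1) (hK : 1 ≤ K) (hα : 0 < α)
    (h : ∀ ω ∈ Δ, ∃ P, IsIdempotentElem P ∧ DichotomyBound univ ω P K α) :
    HasExpDichotomy mode Θ univ Δ := by
  classical
  choose! P hP1 hP2 using h
  refine ⟨P, ?_, hP1, K, hK, α, hα, fun s hs t ht ω hω => hP2 ω hω s hs t ht⟩
  let _ := tripleTopology mode Θ N
  intro ω₀ hω₀
  -- Along any ultrafilter on Δ tending to ω₀, the bounded projections have some limit. It satisfies
  -- the dichotomy estimates at ω₀, so uniqueness identifies it with P ω₀.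
  refine (tendsto_iff_ultrafilter _ _ _).2 fun U hU => ?_
  have hUΔ : ∀ᶠ ω in U, ω ∈ Δ := hU self_mem_nhdsWithin
  have hconv : ConvergesTo mode Θ ρ (U : Filter (Triple N)) (fun ω => ω) ω₀ :=
    ⟨hΘ, hρ, hUΔ.mono hΔ, hΔ _ hω₀, hΔ' _ hω₀, hU.trans inf_le_left⟩
  obtain ⟨P', hP'⟩ := exists_tendsto_of_norm_le U (P := P) (K := K)
    (hUΔ.mono fun ω hω => (hP2 ω hω).norm_le (hΔ ω hω) (mem_univ _))
  have hb := hconv.dichotomyBound hP' fun s t => hUΔ.mono fun ω hω =>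
    fun s' _ t' _ => hP2 ω hω s' trivial t' trivial
  rwa [hb.unique (hΔ _ hω₀) hα (hP2 _ hω₀)] at hP'

end Dichotomy

end CarathODE

/-! ### The three statements -/

theorem mainTheorem5 (N : ℕ) (mode : CarathODE.Mode)
    (f : CarathODE.Car N (CarathODE.Euc N)) (F : CarathODE.Car N (CarathODE.Mat N))
    (hf : CarathODE.IsLC f)
    (hf_bounds : CarathODE.HasEquicontinuousMBounds f)
    (hF : CarathODE.IsSC F)
    (hJ : CarathODE.IsJacobian f F)
    (hF_bounds : mode = CarathODE.Mode.weak → CarathODE.HasEquicontinuousMBounds F)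
    (hglobal : ∀ p ∈ CarathODE.hull mode f F, ∀ x₀ : CarathODE.Euc N,
      ∃ x, CarathODE.IsSolution p.1 x₀ x)
    (ω : CarathODE.Triple N) (hω : ω ∈ CarathODE.Omega mode f F) :
    (CarathODE.HasExpDichotomy mode (CarathODE.theta f) (Set.Iic 0) {ω} →
      CarathODE.HasExpDichotomy mode (CarathODE.theta f) Set.univ
        (CarathODE.alphaLimit mode f F ω)) ∧
    (CarathODE.HasExpDichotomy mode (CarathODE.theta f) (Set.Ici 0) {ω} →
      CarathODE.HasExpDichotomy mode (CarathODE.theta f) Set.univ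
        (CarathODE.omegaLimit mode f F ω)) ∧
    (CarathODE.HasExpDichotomy mode (CarathODE.theta f) Set.univ {ω} →
      CarathODE.HasExpDichotomy mode (CarathODE.theta f) Set.univ
        (CarathODE.orbitHull mode f F ω)) := by
  have hreg : ∀ ω ∈ CarathODE.Omega mode f F,
      CarathODE.IsRegular mode (CarathODE.theta f) (CarathODE.theta F) ω := fun ω hω =>
    CarathODE.isRegular_of_mem_Omega hf hf_bounds hF hF_bounds hglobal hω
  -- The three cases differ only in the filter of times along which the orbit approaches ω'; that
  -- filter must eventually carry each t into J.
  have key : ∀ (J : Set ℝ) (Δ : Set (CarathODE.Triple N)), Δ ⊆ CarathODE.Omega mode f F →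
      (∀ ω' ∈ Δ, ∃ l : Filter ℝ, l.NeBot ∧ (∀ t, ∀ᶠ τ in l, t + τ ∈ J) ∧
        Tendsto (fun τ => CarathODE.baseFlow τ ω) l
          (@nhds _ (CarathODE.tripleTopology mode (CarathODE.theta f) N) ω')) →
      CarathODE.HasExpDichotomy mode (CarathODE.theta f) J {ω} →
      CarathODE.HasExpDichotomy mode (CarathODE.theta f) Set.univ Δ := by
    rintro J Δ hΔ hlim ⟨P, -, hP, K, hK, α, hα, hb⟩
    have hmod := CarathODE.isModulus_theta hf.isSC hf_bounds
    have hmod' := fun hm => CarathODE.isModulus_theta hF (hF_bounds hm)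
    refine CarathODE.hasExpDichotomy_univ_of_forall hmod hmod' (fun ω hω => hreg ω (hΔ hω))
      (fun ω hω => (hΔ hω).2.1) hK hα fun ω' hω' => ?_
    obtain ⟨l, hl, hlJ, hlt⟩ := hlim ω' hω'
    exact CarathODE.exists_dichotomyBound_of_tendsto (hreg ω hω)
      ⟨hmod, hmod', Eventually.of_forall fun τ => (hreg ω hω).baseFlow τ, hreg ω' (hΔ hω'),
        (hΔ hω').2.1, hlt⟩ (hP ω rfl) (fun s hs t ht => hb s hs t ht ω rfl) hlJ
  refine ⟨key _ _ (fun _ h => h.1) ?_, key _ _ (fun _ h => h.1) ?_, key _ _ (fun _ h => h.1) ?_⟩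
  · rintro ω' ⟨-, t, ht, hlim⟩
    exact ⟨map t atTop, inferInstance,
      fun s => (tendsto_atBot_add_const_left _ s ht).eventually (Iic_mem_atBot 0), hlim⟩
  · rintro ω' ⟨-, t, ht, hlim⟩
    exact ⟨map t atTop, inferInstance,
      fun s => (tendsto_atTop_add_const_left _ s ht).eventually (Ici_mem_atTop 0), hlim⟩
  · rintro ω' ⟨-, hcl⟩
    let _ := CarathODE.tripleTopology mode (CarathODE.theta f) N
    -- With J = ℝ the times are unrestricted, so this filter handles points of the orbit and its
    -- limit points alike.
    refine ⟨comap (fun τ => CarathODE.baseFlow τ ω) (𝓝 ω'), ?_, fun _ => by simp, tendsto_comap⟩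
    rw [comap_neBot_iff]
    intro t ht
    obtain ⟨_, h1, τ, rfl⟩ := mem_closure_iff_nhds.1 hcl t ht
    exact ⟨τ, h1⟩
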